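/- Let $M$ be a smooth manifold and $(\mathcal G,[\cdot,\cdot]_{\mathcal G},\langle\cdot,\cdot\rangle_{\mathcal G})$ a quadratic Lie algebra bundle over $M$ (a finite-rank real vector bundle with a smooth fibrewise Lie bracket and a smooth nondegenerate, symmetric, $\mathrm{ad}$-invariant scalar product). Let $\nabla$ be a connection on $\mathcal G$ preserving $[\cdot,\cdot]_{\mathcal G}$ and $\langle\cdot,\cdot\rangle_{\mathcal G}$, and let $R\in\Omega^2(M,\mathcal G)$, $H\in\Omega^3(M)$ satisfy $$R^\nabla(X,Y)r=[R(X,Y),r]_{\mathcal G},\qquad d^\nabla R=0,\qquad dH=\langle R\wedge R\rangle_{\mathcal G}.$$ Let $E=TM\oplus T^*M\oplus\mathcal G$ be the standard Courant algebroid with data $(\nabla,R,H)$: its scalar product is $\langle X+\xi+r,Y+\eta+s\rangle=\tfrac12(\xi(Y)+\eta(X))+\langle r,s\rangle_{\mathcal G}$, and its Dorfman bracket is $$[X+\xi+r,\,Y+\eta+s]=\mathcal L_XY+\big(i_Yi_XH+\mathcal L_X\eta-i_Yd\xi-2\langle i_XR,s\rangle_{\mathcal G}+2\langle i_YR,r\rangle_{\mathcal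 G}+2\langle\nabla r,s\rangle_{\mathcal G}\big)+\big(R(X,Y)+\nabla_Xs-\nabla_Yr+[r,s]_{\mathcal G}\big).$$ All tensors, connections and brackets are extended complex linearly to complexifications. Let $\mathcal J$ be a generalized almost complex structure on $E$, i.e. a smooth skew-symmetric field of endomorphisms of $E$ with $\mathcal J^2=-\mathrm{Id}$, and let $L\subset E^{\mathbb C}$ be its $(1,0)$-bundle (the $i$-eigenbundle). Suppose that at every point $L=L(W,\sigma,\mathcal D,\epsilon)$, where $$L(W,\sigma,\mathcal D,\epsilon)=\{X+\xi+\sigma(X)+r\mid X\in W,\ \xi\in (T^*M)^{\mathbb C},\ r\in\mathcal D,\ \xi(Y)=2\epsilon(X,Y)-\langle\sigma(Y),\sigma(X)+2r\rangle_{\mathcal G}\ \forall Y\in W\};$$ here $W_x\subset(T_xM)^{\mathbb C}$ are complex subspaces of dimension independent of $x\in M$, $\mathcal D_x\subset\mathcal G_x^{\mathbb C}$ are maximal isotropic complex subspaces, and $\sigma$, $\epsilon$ are smooth sections of $\mathrm{Hom}(W,\mathcal G^{\mathbb C})$ and $\Lambda^2W^*$. Then $\mathcal J$ is integrable (i.e.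 $\Gamma(L)$ is closed under the Dorfman bracket) if and only if the following conditions hold: A) $W$ is involutive, i.e. $\Gamma(W)$ is closed under the Lie bracket of complex vector fields; B) $\mathcal D$ is a Lie algebra subbundle of $\mathcal G^{\mathbb C}$, i.e. each fibre $\mathcal D_x$ is a Lie subalgebra; C) the partial connection $(\nabla+\mathrm{ad}_\sigma)_Xr=\nabla_Xr+[\sigma(X),r]_{\mathcal G}$, $X\in\Gamma(W)$, $r\in\Gamma(\mathcal G^{\mathbb C})$, preserves $\mathcal D$, i.e. maps $\Gamma(W)\times\Gamma(\mathcal D)$ to $\Gamma(\mathcal D)$; D) $R(X,Y)+(d^\nabla\sigma)(X,Y)+[\sigma(X),\sigma(Y)]_{\mathcal G}\in\mathcal D$ for all $X,Y\in W$, where $(d^\nabla\sigma)(X,Y)=\nabla_X(\sigma(Y))-\nabla_Y(\sigma(X))-\sigma([X,Y])$ for $X,Y\in\Gamma(W)$; E) on $\Lambda^3W$, $$2\,d\epsilon+H+\langle(d^\nabla\sigma)\wedge\sigma\rangle_{\mathcal G}+2\langle R\wedge\sigma\rangle_{\mathcal G}+2\langle[\sigma,\sigma],\sigma\rangle_{\mathcal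 G}=0,$$ where $\langle\alpha\wedge\sigma\rangle_{\mathcal G}(X,Y,Z)=\langle\alpha(X,Y),\sigma(Z)\rangle_{\mathcal G}+\langle\alpha(Y,Z),\sigma(X)\rangle_{\mathcal G}+\langle\alpha(Z,X),\sigma(Y)\rangle_{\mathcal G}$ for a $\mathcal G^{\mathbb C}$-valued $2$-form $\alpha$ on $W$, $\langle[\sigma,\sigma],\sigma\rangle_{\mathcal G}(X,Y,Z)=\langle[\sigma(X),\sigma(Y)]_{\mathcal G},\sigma(Z)\rangle_{\mathcal G}$, and $d\epsilon$ is given by the usual formula for the exterior derivative in terms of Lie brackets of sections of $W$. ($d^\nabla\sigma$ and $d\epsilon$, hence D) and E), are defined because $W$ is involutive by A).) -/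

import Mathlib

open Bundle Manifold ContDiff VectorField

noncomputable section

namespace Courant

/-! ### Complexification of real vector spaces -/

/-- The complexification `V ⊕ i V` of a real vector space `V`; `⟨a, b⟩` stands for `a + i b`. -/
@[ext] structure Cx (V : Type*) where
  re : V
  im : V

namespace Cx

section
variable {V : Type*} [AddCommGroup V]

instance : Zero (Cx V) := ⟨⟨0, 0⟩⟩
instance : Add (Cx V) := ⟨fun a b => ⟨a.re + b.re, a.im + b.im⟩⟩
instance : Neg (Cx V) := ⟨fun a => ⟨-a.re, -a.im⟩⟩
instance : Sub (Cx V) := ⟨fun a b => ⟨a.re - b.re, a.im - b.im⟩⟩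

@[simp] theorem zero_re : (0 : Cx V).re = 0 := rfl
@[simp] theorem zero_im : (0 : Cx V).im = 0 := rfl
@[simp] theorem add_re (a b : Cx V) : (a + b).re = a.re + b.re := rfl
@[simp] theorem add_im (a b : Cx V) : (a + b).im = a.im + b.im := rfl
@[simp] theorem neg_re (a : Cx V) : (-a).re = -a.re := rfl
@[simp] theorem neg_im (a : Cx V) : (-a).im = -a.im := rfl
@[simp] theorem sub_re (a b : Cx V) : (a - b).re = a.re - b.re := rfl
@[simp] theorem sub_im (a b : Cx V) : (a - b).im = a.im - b.im := rfl

instance : AddCommGroup (Cx V) where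
  add_assoc a b c := by ext <;> simp [add_assoc]
  zero_add a := by ext <;> simp
  add_zero a := by ext <;> simp
  add_comm a b := by ext <;> simp [add_comm]
  neg_add_cancel a := by ext <;> simp
  sub_eq_add_neg a b := by ext <;> simp [sub_eq_add_neg]
  nsmul := nsmulRec
  zsmul := zsmulRec

variable [Module ℝ V]

instance : SMul ℂ (Cx V) :=
  ⟨fun z a => ⟨z.re • a.re - z.im • a.im, z.re • a.im + z.im • a.re⟩⟩

@[simp] theorem smul_re (z : ℂ) (a : Cx V) : (z • a).re = z.re • a.re - z.im • a.im := rfl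
@[simp] theorem smul_im (z : ℂ) (a : Cx V) : (z • a).im = z.re • a.im + z.im • a.re := rfl

instance : Module ℂ (Cx V) where
  one_smul a := by ext <;> simp
  mul_smul z w a := by
    ext <;> simp only [smul_re, smul_im, Complex.mul_re, Complex.mul_im] <;> module
  smul_zero z := by ext <;> simp
  smul_add z a b := by ext <;> simp only [smul_re, smul_im, add_re, add_im] <;> module
  add_smul z w a := by
    ext <;> simp only [smul_re, smul_im, add_re, add_im, Complex.add_re, Complex.add_im] <;> module
  zero_smul a := by ext <;> simp

end

/-- The complex linear extension of a real linear map. -/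
def mapLin {A B : Type*} [AddCommGroup A] [Module ℝ A] [AddCommGroup B] [Module ℝ B]
    (f : A →ₗ[ℝ] B) : Cx A →ₗ[ℂ] Cx B where
  toFun a := ⟨f a.re, f a.im⟩
  map_add' a b := by ext <;> simp
  map_smul' z a := by ext <;> simp

/-- The complex bilinear extension of a real bilinear map `f`. -/
def map₂ {A B C : Type*} [AddCommGroup C] (f : A → B → C) (a : Cx A) (b : Cx B) : Cx C :=
  ⟨f a.re b.re - f a.im b.im, f a.re b.im + f a.im b.re⟩

/-- The complex bilinear extension of a real bilinear form `f`. -/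
def form₂ {A B : Type*} (f : A → B → ℝ) (a : Cx A) (b : Cx B) : ℂ :=
  ⟨f a.re b.re - f a.im b.im, f a.re b.im + f a.im b.re⟩

/-- The complex trilinear extension of a real trilinear form `f`. -/
def form₃ {A B C : Type*} (f : A → B → C → ℝ) (a : Cx A) (b : Cx B) (c : Cx C) : ℂ :=
  ⟨f a.re b.re c.re - f a.re b.im c.im - f a.im b.re c.im - f a.im b.im c.re,
    f a.im b.re c.re + f a.re b.im c.re + f a.re b.re c.im - f a.im b.im c.im⟩

end Cx

/-! ### Smooth sections, differential forms and their exterior derivative -/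

section Smooth

variable (EM : Type*) [NormedAddCommGroup EM] [NormedSpace ℝ EM]
  {M : Type*} [TopologicalSpace M] [ChartedSpace EM M]

/-- `s` is a smooth section of the real vector bundle `V` (with typical fibre `F`) over the manifold
`M` (modelled on `EM`). -/
def SmoothSec (F : Type*) [NormedAddCommGroup F] [NormedSpace ℝ F] {V : M → Type*}
    [TopologicalSpace (TotalSpace F V)] [∀ x, TopologicalSpace (V x)] [FiberBundle F V]
    (s : Π x : M, V x) : Prop :=
  ContMDiff 𝓘(ℝ, EM) (𝓘(ℝ, EM).prod 𝓘(ℝ, F)) ∞ (fun x => TotalSpace.mk' F x (s x))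

/-- `s` is a smooth section of the complexification of `V`. -/
def SmoothCSec (F : Type*) [NormedAddCommGroup F] [NormedSpace ℝ F] {V : M → Type*}
    [TopologicalSpace (TotalSpace F V)] [∀ x, TopologicalSpace (V x)] [FiberBundle F V]
    (s : Π x : M, Cx (V x)) : Prop :=
  SmoothSec EM F (fun x => (s x).re) ∧ SmoothSec EM F (fun x => (s x).im)

/-- `Γ(S)` for a field `S` of complex subspaces of the complexification of the bundle `V`: the
smooth sections of `V^ℂ` with values in `S`. -/
structure CSec (F : Type*) [NormedAddCommGroup F] [NormedSpace ℝ F] {V : M → Type*}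
    [TopologicalSpace (TotalSpace F V)] [∀ x, TopologicalSpace (V x)] [FiberBundle F V]
    [∀ x, AddCommGroup (V x)] [∀ x, Module ℝ (V x)]
    (S : Π x : M, Submodule ℂ (Cx (V x))) where
  val : Π x : M, Cx (V x)
  smooth : SmoothCSec EM F val
  mem : ∀ x, val x ∈ S x

variable {EM}

/-- The value at `x` of a section of `S`, as an element of the fibre `S x`. -/
def CSec.at {F : Type*} [NormedAddCommGroup F] [NormedSpace ℝ F] {V : M → Type*}
    [TopologicalSpace (TotalSpace F V)] [∀ x, TopologicalSpace (V x)] [FiberBundle F V]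
    [∀ x, AddCommGroup (V x)] [∀ x, Module ℝ (V x)]
    {S : Π x : M, Submodule ℂ (Cx (V x))} (s : CSec EM F S) (x : M) : S x :=
  ⟨s.val x, s.mem x⟩

/-- The exterior derivative of an `n`-form on `M`: at `x`, pull the form back to the model space by
the inverse of the preferred chart at `x`, differentiate there, and pull back by the chart. -/
def extD {n : ℕ} (θ : Π x : M, TangentSpace 𝓘(ℝ, EM) x [⋀^Fin n]→L[ℝ] ℝ) (x : M) :
    TangentSpace 𝓘(ℝ, EM) x [⋀^Fin (n + 1)]→L[ℝ] ℝ :=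
  let φ := extChartAt 𝓘(ℝ, EM) x
  let θ' : EM → EM [⋀^Fin n]→L[ℝ] ℝ := fun e =>
    (θ (φ.symm e)).compContinuousLinearMap (mfderiv 𝓘(ℝ, EM) 𝓘(ℝ, EM) φ.symm e)
  (extDeriv θ' (φ x)).compContinuousLinearMap (mfderiv 𝓘(ℝ, EM) 𝓘(ℝ, EM) φ x)

/-- `i_Y dξ` for a 1-form `ξ` and a tangent vector `Y` at `x`. -/
def iD (ξ : Π x : M, TangentSpace 𝓘(ℝ, EM) x →L[ℝ] ℝ) (x : M) (Y : TangentSpace 𝓘(ℝ, EM) x) :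
    TangentSpace 𝓘(ℝ, EM) x →L[ℝ] ℝ :=
  (extD (n := 1) (fun y => ContinuousAlternatingMap.ofSubsingleton ℝ _ ℝ (0 : Fin 1) (ξ y))
    x).toContinuousLinearMap ![Y, 0] 1

/-- The Lie derivative `L_X η = d(η(X)) + i_X dη` of a 1-form. -/
def lieD (X : Π x : M, TangentSpace 𝓘(ℝ, EM) x) (η : Π x : M, TangentSpace 𝓘(ℝ, EM) x →L[ℝ] ℝ)
    (x : M) : TangentSpace 𝓘(ℝ, EM) x →L[ℝ] ℝ :=
  mvfderiv 𝓘(ℝ, EM) (fun y => η y (X y)) x + iD η x (X x)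

/-- The Lie bracket of complex vector fields. -/
def cLie (X Y : Π x : M, Cx (TangentSpace 𝓘(ℝ, EM) x)) (x : M) : Cx (TangentSpace 𝓘(ℝ, EM) x) :=
  ⟨mlieBracket 𝓘(ℝ, EM) (fun y => (X y).re) (fun y => (Y y).re) x
      - mlieBracket 𝓘(ℝ, EM) (fun y => (X y).im) (fun y => (Y y).im) x,
    mlieBracket 𝓘(ℝ, EM) (fun y => (X y).re) (fun y => (Y y).im) x
      + mlieBracket 𝓘(ℝ, EM) (fun y => (X y).im) (fun y => (Y y).re) x⟩

/-- The derivative `X(f)` of a complex function along a complex vector field. -/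
def cDer (X : Π x : M, Cx (TangentSpace 𝓘(ℝ, EM) x)) (f : M → ℂ) (x : M) : ℂ :=
  mvfderiv 𝓘(ℝ, EM) f x (X x).re + Complex.I * mvfderiv 𝓘(ℝ, EM) f x (X x).im

variable [IsManifold 𝓘(ℝ, EM) ∞ M]

/-- A 1-form is smooth: its values on smooth vector fields are smooth functions. -/
def SmoothOneForm (ξ : Π x : M, TangentSpace 𝓘(ℝ, EM) x →L[ℝ] ℝ) : Prop :=
  ∀ X : Π x : M, TangentSpace 𝓘(ℝ, EM) x, SmoothSec EM EM X →
    ContMDiff 𝓘(ℝ, EM) 𝓘(ℝ, ℝ) ∞ (fun x => ξ x (X x))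

end Smooth

/-! ### Standard Courant algebroids -/

section CourantAlgebroid

variable (EM : Type*) [NormedAddCommGroup EM] [NormedSpace ℝ EM]
  {M : Type*} [TopologicalSpace M] [ChartedSpace EM M] [IsManifold 𝓘(ℝ, EM) ∞ M]
  (F : Type*) [NormedAddCommGroup F] [NormedSpace ℝ F]
  (G : M → Type*) [TopologicalSpace (TotalSpace F G)]
  [∀ x, AddCommGroup (G x)] [∀ x, Module ℝ (G x)] [∀ x, TopologicalSpace (G x)]
  [∀ x, IsTopologicalAddGroup (G x)] [∀ x, ContinuousSMul ℝ (G x)]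
  [FiberBundle F G] [VectorBundle ℝ F G]

/-- A quadratic Lie algebra bundle structure on the vector bundle `G`: a smooth Lie bracket `br` on
the fibres and a smooth nondegenerate symmetric `ad`-invariant scalar product `ip`. -/
structure QuadraticLieBundle where
  br : Π x : M, G x →L[ℝ] G x →L[ℝ] G x
  ip : Π x : M, G x →L[ℝ] G x →L[ℝ] ℝ
  br_smooth : ∀ r s : Π x, G x, SmoothSec EM F r → SmoothSec EM F s →
    SmoothSec EM F (fun x => br x (r x) (s x))
  ip_smooth : ∀ r s : Π x, G x, SmoothSec EM F r → SmoothSec EM F s →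
    ContMDiff 𝓘(ℝ, EM) 𝓘(ℝ, ℝ) ∞ (fun x => ip x (r x) (s x))
  br_self : ∀ x r, br x r r = 0
  jacobi : ∀ x r s t, br x r (br x s t) = br x (br x r s) t + br x s (br x r t)
  ip_symm : ∀ x r s, ip x r s = ip x s r
  ip_nondegenerate : ∀ x r, (∀ s, ip x r s = 0) → r = 0
  ip_invariant : ∀ x r s t, ip x (br x r s) t + ip x s (br x r t) = 0

/-- The defining data `(∇, R, H)` of a standard Courant algebroid `TM ⊕ T*M ⊕ G`, where `G` is a
quadratic Lie algebra bundle. (Since `∇` preserves the bracket and the scalar product, `G` is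
locally trivial as a bundle of quadratic Lie algebras.) -/
structure StandardCourant extends QuadraticLieBundle EM F G where
  /-- the connection; `nabla r x v` is `(∇_v r)(x)` -/
  nabla : CovariantDerivative 𝓘(ℝ, EM) F G
  nabla_smooth : CovariantDerivative.ContMDiffCovariantDerivative nabla ∞
  R : Π x : M, TangentSpace 𝓘(ℝ, EM) x [⋀^Fin 2]→L[ℝ] G x
  R_smooth : ∀ X Y : Π x : M, TangentSpace 𝓘(ℝ, EM) x, SmoothSec EM EM X → SmoothSec EM EM Y →
    SmoothSec EM F (fun x => R x ![X x, Y x])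
  H : Π x : M, TangentSpace 𝓘(ℝ, EM) x [⋀^Fin 3]→L[ℝ] ℝ
  H_smooth : ∀ X Y Z : Π x : M, TangentSpace 𝓘(ℝ, EM) x,
    SmoothSec EM EM X → SmoothSec EM EM Y → SmoothSec EM EM Z →
    ContMDiff 𝓘(ℝ, EM) 𝓘(ℝ, ℝ) ∞ (fun x => H x ![X x, Y x, Z x])
  /-- `∇` preserves the Lie bracket -/
  nabla_br : ∀ r s : Π x, G x, SmoothSec EM F r → SmoothSec EM F s → ∀ x v,
    nabla (fun y => br y (r y) (s y)) x v = br x (nabla r x v) (s x) + br x (r x) (nabla s x v)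
  /-- `∇` preserves the scalar product -/
  nabla_ip : ∀ r s : Π x, G x, SmoothSec EM F r → SmoothSec EM F s → ∀ x v,
    mvfderiv 𝓘(ℝ, EM) (fun y => ip y (r y) (s y)) x v
      = ip x (nabla r x v) (s x) + ip x (r x) (nabla s x v)
  /-- the curvature of `∇` is `ad_R` -/
  curvature : ∀ (X Y : Π x : M, TangentSpace 𝓘(ℝ, EM) x) (r : Π x, G x),
    SmoothSec EM EM X → SmoothSec EM EM Y → SmoothSec EM F r → ∀ x,
    nabla (fun y => nabla r y (Y y)) x (X x) - nabla (fun y => nabla r y (X y)) x (Y x)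
      - nabla r x (mlieBracket 𝓘(ℝ, EM) X Y x) = br x (R x ![X x, Y x]) (r x)
  /-- `d^∇ R = 0` -/
  bianchi : ∀ X Y Z : Π x : M, TangentSpace 𝓘(ℝ, EM) x,
    SmoothSec EM EM X → SmoothSec EM EM Y → SmoothSec EM EM Z → ∀ x,
    nabla (fun y => R y ![Y y, Z y]) x (X x) - nabla (fun y => R y ![X y, Z y]) x (Y x)
      + nabla (fun y => R y ![X y, Y y]) x (Z x)
      - R x ![mlieBracket 𝓘(ℝ, EM) X Y x, Z x] + R x ![mlieBracket 𝓘(ℝ, EM) X Z x, Y x]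
      - R x ![mlieBracket 𝓘(ℝ, EM) Y Z x, X x] = 0
  /-- `dH = ⟨R ∧ R⟩` -/
  dH : ∀ x (a b c d : TangentSpace 𝓘(ℝ, EM) x), extD H x ![a, b, c, d]
    = 2 * (ip x (R x ![a, b]) (R x ![c, d]) - ip x (R x ![a, c]) (R x ![b, d])
      + ip x (R x ![a, d]) (R x ![b, c]))

/-- The fibre at `x` of `E = TM ⊕ T*M ⊕ G`; the element `(X, ξ, r)` stands for `X + ξ + r`. -/
abbrev Fib (x : M) : Type _ :=
  TangentSpace 𝓘(ℝ, EM) x × (TangentSpace 𝓘(ℝ, EM) x →L[ℝ] ℝ) × G x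

variable {EM F G}

variable (F) in
/-- `u` is a smooth section of `E = TM ⊕ T*M ⊕ G`. -/
def SmoothE (u : Π x : M, Fib EM G x) : Prop :=
  SmoothSec EM EM (fun x => (u x).1) ∧ SmoothOneForm (fun x => (u x).2.1) ∧
    SmoothSec EM F (fun x => (u x).2.2)

namespace StandardCourant

variable (C : StandardCourant EM F G)

/-- The scalar product `⟨X + ξ + r, Y + η + s⟩ = (ξ(Y) + η(X)) / 2 + ⟨r, s⟩` of `E`. -/
def pairing (x : M) (u v : Fib EM G x) : ℝ :=
  (u.2.1 v.1 + v.2.1 u.1) / 2 + C.ip x u.2.2 v.2.2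

/-- The Dorfman bracket of `E`. For `u = X + ξ + r` and `v = Y + η + s` its components are
`L_X Y`, `i_Y i_X H + L_X η - i_Y dξ - 2⟨i_X R, s⟩ + 2⟨i_Y R, r⟩ + 2⟨∇r, s⟩` and
`R(X, Y) + ∇_X s - ∇_Y r + [r, s]`. -/
def dorfman (u v : Π x : M, Fib EM G x) (x : M) : Fib EM G x :=
  (mlieBracket 𝓘(ℝ, EM) (fun y => (u y).1) (fun y => (v y).1) x,
   (C.H x).toContinuousLinearMap ![(u x).1, (v x).1, 0] 2
    + lieD (fun y => (u y).1) (fun y => (v y).2.1) x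
    - iD (fun y => (u y).2.1) x (v x).1
    - (2 : ℝ) • (C.ip x (v x).2.2).comp ((C.R x).toContinuousLinearMap ![(u x).1, 0] 1)
    + (2 : ℝ) • (C.ip x (u x).2.2).comp ((C.R x).toContinuousLinearMap ![(v x).1, 0] 1)
    + (2 : ℝ) • (C.ip x (v x).2.2).comp (C.nabla (fun y => (u y).2.2) x),
   C.R x ![(u x).1, (v x).1] + C.nabla (fun y => (v y).2.2) x (u x).1
    - C.nabla (fun y => (u y).2.2) x (v x).1 + C.br x (u x).2.2 (v x).2.2)

/-- The complex bilinear extension of the Dorfman bracket to sections of `E^ℂ`. -/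
def cDorfman (u v : Π x : M, Cx (Fib EM G x)) (x : M) : Cx (Fib EM G x) :=
  ⟨C.dorfman (fun y => (u y).re) (fun y => (v y).re) x
      - C.dorfman (fun y => (u y).im) (fun y => (v y).im) x,
    C.dorfman (fun y => (u y).re) (fun y => (v y).im) x
      + C.dorfman (fun y => (u y).im) (fun y => (v y).re) x⟩

/-- The complex bilinear Lie bracket of `G^ℂ`. -/
def cBr (x : M) (r s : Cx (G x)) : Cx (G x) := Cx.map₂ (fun a b => C.br x a b) r s

/-- The complex bilinear scalar product of `G^ℂ`. -/
def cIp (x : M) (r s : Cx (G x)) : ℂ := Cx.form₂ (fun a b => C.ip x a b) r s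

/-- The complex bilinear extension of the 2-form `R`. -/
def cR (x : M) (X Y : Cx (TangentSpace 𝓘(ℝ, EM) x)) : Cx (G x) :=
  Cx.map₂ (fun a b => C.R x ![a, b]) X Y

/-- The complex trilinear extension of the 3-form `H`. -/
def cH (x : M) (X Y Z : Cx (TangentSpace 𝓘(ℝ, EM) x)) : ℂ :=
  Cx.form₃ (fun a b c => C.H x ![a, b, c]) X Y Z

/-- The complex extension of the connection: `cNabla X r x` is `(∇_X r)(x)`. -/
def cNabla (X : Π x : M, Cx (TangentSpace 𝓘(ℝ, EM) x)) (r : Π x : M, Cx (G x)) (x : M) : Cx (G x) :=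
  ⟨C.nabla (fun y => (r y).re) x (X x).re - C.nabla (fun y => (r y).im) x (X x).im,
    C.nabla (fun y => (r y).im) x (X x).re + C.nabla (fun y => (r y).re) x (X x).im⟩

/-- A subspace of `(G x)^ℂ` is isotropic. -/
def IsIsotropic (x : M) (D : Submodule ℂ (Cx (G x))) : Prop :=
  ∀ r ∈ D, ∀ s ∈ D, C.cIp x r s = 0

/-- A generalized almost complex structure on `E`: a smooth skew-symmetric field of endomorphisms
with square `-1`. -/
structure GenAlmostComplex where
  J : Π x : M, Fib EM G x →ₗ[ℝ] Fib EM G x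
  smooth : ∀ u : Π x : M, Fib EM G x, SmoothE F u → SmoothE F (fun x => J x (u x))
  skew : ∀ x u v, C.pairing x (J x u) v + C.pairing x u (J x v) = 0
  sq : ∀ x u, J x (J x u) = -u

variable {C}

/-- The `(1,0)`-bundle of `𝒥`: the `i`-eigenspaces of `𝒥` in `E^ℂ`. -/
def GenAlmostComplex.oneZero (𝒥 : C.GenAlmostComplex) (x : M) : Submodule ℂ (Cx (Fib EM G x)) :=
  Module.End.eigenspace (Cx.mapLin (𝒥.J x)) Complex.I

/-- `𝒥` is integrable: `Γ(L)` is closed under the Dorfman bracket, `L` being the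
`(1,0)`-bundle. -/
def GenAlmostComplex.Integrable (𝒥 : C.GenAlmostComplex) : Prop :=
  ∀ u v : Π x : M, Cx (Fib EM G x),
    SmoothE F (fun x => (u x).re) → SmoothE F (fun x => (u x).im) →
    SmoothE F (fun x => (v x).re) → SmoothE F (fun x => (v x).im) →
    (∀ x, u x ∈ 𝒥.oneZero x) → (∀ x, v x ∈ 𝒥.oneZero x) →
    ∀ x, C.cDorfman u v x ∈ 𝒥.oneZero x

variable (C)

/-- Data `(W, σ, D, ε)` on `E^ℂ`: a field `W` of subspaces of `(TM)^ℂ` of constant dimension, smooth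
sections `σ` of `Hom(W, G^ℂ)` and `ε` of `Λ²W*`, and a field `D` of maximal isotropic subspaces of
`G^ℂ`. -/
structure DiracData where
  W : Π x : M, Submodule ℂ (Cx (TangentSpace 𝓘(ℝ, EM) x))
  σ : Π x : M, W x →ₗ[ℂ] Cx (G x)
  D : Π x : M, Submodule ℂ (Cx (G x))
  ε : Π x : M, W x [⋀^Fin 2]→ₗ[ℂ] ℂ
  W_rank : ∃ k : ℕ, ∀ x, Module.finrank ℂ (W x) = k
  D_maximal : ∀ x, Maximal (C.IsIsotropic x) (D x)
  σ_smooth : ∀ X : CSec EM EM W, SmoothCSec EM F (fun x => σ x (X.at x))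
  ε_smooth : ∀ X Y : CSec EM EM W, ContMDiff 𝓘(ℝ, EM) 𝓘(ℝ, ℂ) ∞ (fun x => ε x ![X.at x, Y.at x])

namespace DiracData

variable {C} (S : C.DiracData)

/-- The fibre `L(W, σ, D, ε)_x`: all `X + ξ + σ(X) + r` with `X ∈ W`, `ξ ∈ (T*M)^ℂ`, `r ∈ D` and
`ξ(Y) = 2 ε(X, Y) - ⟨σ(Y), σ(X) + 2 r⟩` for all `Y ∈ W`. -/
def L (x : M) : Set (Cx (Fib EM G x)) :=
  {u | ∃ (X : S.W x) (ξ : Cx (TangentSpace 𝓘(ℝ, EM) x →L[ℝ] ℝ)) (r : Cx (G x)), r ∈ S.D x ∧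
    (∀ Y : S.W x, Cx.form₂ (fun α v => α v) ξ Y.1
      = 2 * S.ε x ![X, Y] - C.cIp x (S.σ x Y) (S.σ x X + (2 : ℂ) • r)) ∧
    u = ⟨(X.1.re, ξ.re, (S.σ x X + r).re), (X.1.im, ξ.im, (S.σ x X + r).im)⟩}

/-- A) `W` is involutive. -/
def Involutive : Prop :=
  ∀ (X Y : CSec EM EM S.W) (x : M), cLie X.val Y.val x ∈ S.W x

/-- B) The fibres of `D` are Lie subalgebras. -/
def IsLieSubalgebraBundle : Prop :=
  ∀ x, ∀ r ∈ S.D x, ∀ s ∈ S.D x, C.cBr x r s ∈ S.D x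

/-- C) The partial connection `∇ + ad_σ` preserves `D`. -/
def PartialConnectionPreserves : Prop :=
  ∀ (X : CSec EM EM S.W) (r : CSec EM F S.D) (x : M),
    C.cNabla X.val r.val x + C.cBr x (S.σ x (X.at x)) (r.val x) ∈ S.D x

variable {S}

/-- The Lie bracket of two sections of an involutive `W`, as a section of `W`. -/
def bracket (hW : S.Involutive) (X Y : CSec EM EM S.W) (x : M) : S.W x :=
  ⟨cLie X.val Y.val x, hW X Y x⟩

/-- `(d^∇ σ)(X, Y) = ∇_X (σ(Y)) - ∇_Y (σ(X)) - σ([X, Y])` for sections `X, Y` of `W`. -/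
def dσ (hW : S.Involutive) (X Y : CSec EM EM S.W) (x : M) : Cx (G x) :=
  C.cNabla X.val (fun y => S.σ y (Y.at y)) x - C.cNabla Y.val (fun y => S.σ y (X.at y)) x
    - S.σ x (bracket hW X Y x)

/-- `(dε)(X, Y, Z)` for sections `X, Y, Z` of `W`. -/
def dε (hW : S.Involutive) (X Y Z : CSec EM EM S.W) (x : M) : ℂ :=
  cDer X.val (fun y => S.ε y ![Y.at y, Z.at y]) x
    - cDer Y.val (fun y => S.ε y ![X.at y, Z.at y]) x
    + cDer Z.val (fun y => S.ε y ![X.at y, Y.at y]) x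
    - S.ε x ![bracket hW X Y x, Z.at x] + S.ε x ![bracket hW X Z x, Y.at x]
    - S.ε x ![bracket hW Y Z x, X.at x]

/-- `⟨α ∧ σ⟩(X, Y, Z) = ⟨α(X, Y), σ(Z)⟩ + ⟨α(Y, Z), σ(X)⟩ + ⟨α(Z, X), σ(Y)⟩` for a 2-form `α` on `W`
with values in `G^ℂ`. -/
def wedgeσ (α : CSec EM EM S.W → CSec EM EM S.W → Π x : M, Cx (G x))
    (X Y Z : CSec EM EM S.W) (x : M) : ℂ :=
  C.cIp x (α X Y x) (S.σ x (Z.at x)) + C.cIp x (α Y Z x) (S.σ x (X.at x))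
    + C.cIp x (α Z X x) (S.σ x (Y.at x))

/-- D) `R(X, Y) + (d^∇ σ)(X, Y) + [σ(X), σ(Y)]` lies in `D`. -/
def CurvatureCondition (hW : S.Involutive) : Prop :=
  ∀ (X Y : CSec EM EM S.W) (x : M),
    C.cR x (X.val x) (Y.val x) + dσ hW X Y x + C.cBr x (S.σ x (X.at x)) (S.σ x (Y.at x)) ∈ S.D x

/-- E) `2 dε + H + ⟨d^∇σ ∧ σ⟩ + 2⟨R ∧ σ⟩ + 2⟨[σ, σ], σ⟩ = 0` on `Λ³W`. -/
def ThreeFormCondition (hW : S.Involutive) : Prop :=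
  ∀ (X Y Z : CSec EM EM S.W) (x : M),
    2 * dε hW X Y Z x + C.cH x (X.val x) (Y.val x) (Z.val x) + wedgeσ (dσ hW) X Y Z x
      + 2 * wedgeσ (fun X Y x => C.cR x (X.val x) (Y.val x)) X Y Z x
      + 2 * C.cIp x (C.cBr x (S.σ x (X.at x)) (S.σ x (Y.at x))) (S.σ x (Z.at x)) = 0

end DiracData

end StandardCourant

end CourantAlgebroid

end Courant

end

/-!
The statement is obtained by evaluating the Dorfman bracket on arbitrary sections of `L`.

A section of `L = L(W, σ, D, ε)` is `u = X + ξ + σ(X) + r` with sections `X` of `W` and `r` of `D`,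
where the restriction of `ξ` to `W` is prescribed by `X` and `r` (`IsLift`). For another such
section `v = Y + η + σ(Y) + s`, the vector part of `[u, v]` is the Lie bracket of `X` and `Y`, so it
lies in `W` for all `u` and `v` if and only if `W` is involutive. Subtracting `σ([X, Y])` from the
`G`-part of `[u, v]` leaves

  `K(X, Y) + ∇^σ_X s - ∇^σ_Y r + [r, s]`,

where `∇^σ = ∇ + ad_σ` is the partial connection and `K = R + d^∇ σ + [σ, σ]`
(`IsLift.gPart_cDorfman_sub`). The restriction to `W` of the covector part of `[u, v]` differs from
the value which membership in `L` requires by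

  `E(X, Y, V) - 2⟨K(X, V), s⟩ + 2⟨K(Y, V), r⟩ + 2⟨∇^σ_V r, s⟩`,

where `E` is the 3-form `2 dε + H + ⟨d^∇σ ∧ σ⟩ + 2⟨R ∧ σ⟩ + 2⟨[σ, σ], σ⟩`
(`IsLift.cEv_cDorfman`). This is a direct computation from the compatibility of `∇` with the scalar
product and from `ad`-invariance.

If A) to E) hold, the first expression lies in `D`, and the second one vanishes because `E`
is zero and `D` is isotropic. Conversely, when `L` is closed under the bracket, taking some of the
sections `X, Y, r, s` to be zero isolates `K`, the partial connection, the bracket on `D`, and `E`.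

The converse needs enough sections of `L`. Vectors of `L` extend to sections, by projecting a
section of `E^ℂ` with `(1 - i𝒥) / 2`; their components are sections of `W` and `D` through given
vectors (`exists_section_of_mem_W_of_mem_D`). Hence `W`, which has constant rank, has local frames,
and the functional on `W` attached to a pair `(X, r)` extends to a smooth complex 1-form, locally by
Cramer's rule and globally by a partition of unity (`exists_oneForm_extension`). So every pair
`(X, r)` comes from a section of `L` (`exists_isLift`).
-/

noncomputable section

namespace Courant

open Topology

/-! ### Extension of vectors to smooth sections -/

section

variable {EM : Type*} [NormedAddCommGroup EM] [NormedSpace ℝ EM] [FiniteDimensional ℝ EM]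
  {M : Type*} [TopologicalSpace M] [T2Space M] [ChartedSpace EM M] [IsManifold 𝓘(ℝ, EM) ∞ M]
  {F : Type*} [NormedAddCommGroup F] [NormedSpace ℝ F]
  {V : M → Type*} [TopologicalSpace (TotalSpace F V)]
  [∀ x, AddCommGroup (V x)] [∀ x, Module ℝ (V x)] [∀ x, TopologicalSpace (V x)]
  [FiberBundle F V] [VectorBundle ℝ F V] [ContMDiffVectorBundle ∞ F V 𝓘(ℝ, EM)]

variable (V) in
/-- There is a global smooth section which, near `x₀`, is constant with value `w` in the
trivialization at `x₀`. -/
theorem exists_smoothSec_eventuallyEq_symmL (x₀ : M) (w : F) :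
    ∃ s : Π x, V x, SmoothSec EM F s ∧
      ∀ᶠ y in 𝓝 x₀, s y = (trivializationAt F V x₀).symmL ℝ y w := by
  set t := trivializationAt F V x₀
  have hx₀ : x₀ ∈ t.baseSet := FiberBundle.mem_baseSet_trivializationAt' x₀
  have hts : ContMDiffOn 𝓘(ℝ, EM) (𝓘(ℝ, EM).prod 𝓘(ℝ, F)) ∞
      (fun x => TotalSpace.mk' F x (t.symmL ℝ x w)) t.baseSet := by
    intro x hx
    rw [t.contMDiffWithinAt_section _ hx]
    exact (contMDiffOn_const (c := w) x hx).congr (fun y hy => by simp [hy]) (by simp [hx])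
  obtain ⟨χ, hχ, -⟩ := (SmoothBumpFunction.nhds_basis_support (I := 𝓘(ℝ, EM))
    (t.open_baseSet.mem_nhds hx₀)).mem_iff.1 (t.open_baseSet.mem_nhds hx₀)
  refine ⟨(χ : M → ℝ) • fun x => t.symmL ℝ x w,
    ContMDiffOn.smul_section_of_tsupport χ.contMDiff.contMDiffOn t.open_baseSet hχ hts, ?_⟩
  filter_upwards [χ.eventuallyEq_one] with y hy
  simp [hy, t]

theorem exists_smoothSec_apply_eq {x₀ : M} (v : V x₀) :
    ∃ s : Π x, V x, SmoothSec EM F s ∧ s x₀ = v := by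
  obtain ⟨s, hs, h⟩ := exists_smoothSec_eventuallyEq_symmL (EM := EM) V x₀
    (trivializationAt F V x₀ ⟨x₀, v⟩).2
  refine ⟨s, hs, ?_⟩
  rw [h.self_of_nhds]
  simp [FiberBundle.mem_baseSet_trivializationAt' x₀]

end

/-! ### The differential of a 1-form through Lie brackets -/

section

variable {EM : Type*} [NormedAddCommGroup EM] [NormedSpace ℝ EM] [FiniteDimensional ℝ EM]
  {M : Type*} [TopologicalSpace M] [T2Space M] [ChartedSpace EM M] [IsManifold 𝓘(ℝ, EM) ∞ M]

/-- A smooth 1-form, read in the chart at `x`, is differentiable. Smoothness being defined by values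
on global vector fields, one evaluates on fields which are constant in the chart near `x`. -/
theorem SmoothOneForm.differentiableAt_chart
    {ξ : Π x : M, TangentSpace 𝓘(ℝ, EM) x →L[ℝ] ℝ} (hξ : SmoothOneForm ξ) (x : M) :
    DifferentiableAt ℝ (fun e : EM => ((ξ ((extChartAt 𝓘(ℝ, EM) x).symm e)).comp
      (mfderiv 𝓘(ℝ, EM) 𝓘(ℝ, EM) (extChartAt 𝓘(ℝ, EM) x).symm e) : EM →L[ℝ] ℝ))
      (extChartAt 𝓘(ℝ, EM) x x) := by
  set φ := extChartAt 𝓘(ℝ, EM) x with hφ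
  have htgt : ∀ᶠ e in 𝓝 (φ x), e ∈ φ.target := extChartAt_target_mem_nhds x
  have hcont : Filter.Tendsto φ.symm (𝓝 (φ x)) (𝓝 x) := by
    simpa [hφ] using (continuousAt_extChartAt_symm (I := 𝓘(ℝ, EM)) x).tendsto
  have key : ∀ v : EM, ContDiffAt ℝ ∞ (fun e : EM =>
      (ξ (φ.symm e) (mfderiv 𝓘(ℝ, EM) 𝓘(ℝ, EM) φ.symm e v) : ℝ)) (φ x) := by
    intro v
    obtain ⟨s, hs, h⟩ := exists_smoothSec_eventuallyEq_symmL (EM := EM)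
      (fun x : M => TangentSpace 𝓘(ℝ, EM) x) x v
    have h1 : ContDiffAt ℝ ∞ (fun e => ξ (φ.symm e) (s (φ.symm e))) (φ x) := by
      rw [← contMDiffAt_iff_contDiffAt]
      exact (hξ s hs).contMDiffAt.comp (φ x)
        (contMDiffOn_extChartAt_symm x |>.contMDiffAt (extChartAt_target_mem_nhds x))
    refine h1.congr_of_eventuallyEq ?_
    filter_upwards [htgt, hcont.eventually h] with e he hse
    have hsrc : φ.symm e ∈ (chartAt EM x).source := by
      simpa [hφ] using φ.map_target he
    rw [hse, TangentBundle.symmL_trivializationAt hsrc, ← hφ, φ.right_inv he]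
    simp only [modelWithCornersSelf_coe, Set.range_id, mfderivWithin_univ]
    rfl
  -- Differentiability at a point is obtained from `C^1` on a neighbourhood, where the criterion
  -- `contDiffOn_clm_apply` applies.
  have key2 : ∀ᶠ e in 𝓝 (φ x), ∀ i, ContDiffAt ℝ 1 (fun e : EM =>
      (ξ (φ.symm e) (mfderiv 𝓘(ℝ, EM) 𝓘(ℝ, EM) φ.symm e (Module.finBasis ℝ EM i)) : ℝ)) e :=
    Filter.eventually_all.2 fun i => ((key _).of_le (by simp)).eventually (by simp)
  obtain ⟨u, hu, huo, hxu⟩ := eventually_nhds_iff.1 key2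
  have : ContDiffOn ℝ 1 (fun e : EM => ((ξ (φ.symm e)).comp
      (mfderiv 𝓘(ℝ, EM) 𝓘(ℝ, EM) φ.symm e) : EM →L[ℝ] ℝ)) u := by
    rw [contDiffOn_clm_apply]
    intro v
    have hv : (fun e : EM => ((ξ (φ.symm e)).comp
        (mfderiv 𝓘(ℝ, EM) 𝓘(ℝ, EM) φ.symm e) : EM →L[ℝ] ℝ) v) =
        fun e => ∑ i, (Module.finBasis ℝ EM).repr v i •
        (ξ (φ.symm e) (mfderiv 𝓘(ℝ, EM) 𝓘(ℝ, EM) φ.symm e (Module.finBasis ℝ EM i)) : ℝ) := by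
      ext e
      conv_lhs => rw [← (Module.finBasis ℝ EM).sum_repr v]
      rw [map_sum]
      simp only [map_smul]
      rfl
    rw [hv]
    exact ContDiffOn.sum fun i _ => ContDiffOn.fun_smul contDiffOn_const
      fun e he => (hu e he i).contDiffWithinAt
  exact (this.contDiffAt (huo.mem_nhds hxu)).differentiableAt one_ne_zero

/-- Cartan's formula `dξ(Y, V) = Y(ξ(V)) - V(ξ(Y)) - ξ([Y, V])` for the exterior derivative defined
in the preferred chart. It is reduced to the same formula in the model space, applied to the form
and the vector fields read in that chart. -/
theorem iD_apply {ξ : Π x : M, TangentSpace 𝓘(ℝ, EM) x →L[ℝ] ℝ} (hξ : SmoothOneForm ξ)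
    {Y V : Π x : M, TangentSpace 𝓘(ℝ, EM) x} (hY : SmoothSec EM EM Y) (hV : SmoothSec EM EM V)
    (x : M) :
    iD ξ x (Y x) (V x) = mvfderiv 𝓘(ℝ, EM) (fun y => ξ y (V y)) x (Y x)
      - mvfderiv 𝓘(ℝ, EM) (fun y => ξ y (Y y)) x (V x) - ξ x (mlieBracket 𝓘(ℝ, EM) Y V x) := by
  set φ := extChartAt 𝓘(ℝ, EM) x with hφ
  have htgt : ∀ᶠ e in 𝓝 (φ x), e ∈ φ.target := extChartAt_target_mem_nhds x
  -- `loc Z` and `α` are the vector field `Z` and the form `ξ`, read in the chart.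
  let loc (Z : Π x : M, TangentSpace 𝓘(ℝ, EM) x) : EM → EM :=
    mpullbackWithin 𝓘(ℝ, EM) 𝓘(ℝ, EM) φ.symm Z (Set.range 𝓘(ℝ, EM))
  let α : EM → EM →L[ℝ] ℝ := fun e => (ξ (φ.symm e)).comp
      (mfderiv 𝓘(ℝ, EM) 𝓘(ℝ, EM) φ.symm e)
  have hloc : ∀ Z, SmoothSec EM EM Z → DifferentiableAt ℝ (loc Z) (φ x) := by
    intro Z hZ
    have := MDifferentiableWithinAt.differentiableWithinAt_mpullbackWithin_vectorField
      ((hZ.contMDiffAt (x := x)).mdifferentiableAt (by simp)).mdifferentiableWithinAt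
      (s := Set.univ)
    simp only [modelWithCornersSelf_coe, Set.range_id, Set.preimage_univ, Set.univ_inter] at this
    rw [← differentiableWithinAt_univ]
    simpa only [loc, modelWithCornersSelf_coe, Set.range_id] using this
  have hαloc : ∀ Z, ∀ e ∈ φ.target, α e (loc Z e) = ξ (φ.symm e) (Z (φ.symm e)) := by
    intro Z e he
    have hinv := isInvertible_mfderivWithin_extChartAt_symm (I := 𝓘(ℝ, EM)) he
    have := hinv.self_apply_inverse (Z (φ.symm e))
    simp only [modelWithCornersSelf_coe, Set.range_id, mfderivWithin_univ] at this
    simp only [α, loc, mpullbackWithin_apply,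
      modelWithCornersSelf_coe, Set.range_id, mfderivWithin_univ]
    exact congrArg (ξ (φ.symm e)) this
  -- Since `T_xM` is identified with `EM` through the preferred chart at `x`, the chart and its
  -- inverse have the identity as derivative at the point `x` itself.
  let A : EM →L[ℝ] EM := mfderiv 𝓘(ℝ, EM) 𝓘(ℝ, EM) φ x
  let B : EM →L[ℝ] EM := mfderiv 𝓘(ℝ, EM) 𝓘(ℝ, EM) φ.symm (φ x)
  have hA : A = ContinuousLinearMap.id ℝ EM := by
    ext v
    have h : A = tangentCoordChange 𝓘(ℝ, EM) x x x :=
      mfderiv_chartAt_eq_tangentCoordChange (I := 𝓘(ℝ, EM)) (mem_chart_source EM x)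
    rw [h]
    exact tangentCoordChange_self (mem_extChartAt_source (I := 𝓘(ℝ, EM)) x)
  have hB : B = ContinuousLinearMap.id ℝ EM := by
    have h := mfderivWithin_extChartAt_symm_comp_mfderiv_extChartAt'
      (mem_extChartAt_source (I := 𝓘(ℝ, EM)) x)
    simp only [modelWithCornersSelf_coe, Set.range_id, mfderivWithin_univ] at h
    have h' : B.comp A = ContinuousLinearMap.id ℝ EM := h
    rwa [hA, ContinuousLinearMap.comp_id] at h'
  have hder : ∀ Z, SmoothSec EM EM Z → ∀ v,
      fderiv ℝ (fun e => α e (loc Z e)) (φ x) v = mvfderiv 𝓘(ℝ, EM) (fun y => ξ y (Z y)) x v := by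
    intro Z hZ v
    rw [Filter.EventuallyEq.fderiv_eq (htgt.mono (hαloc Z)), MDifferentiableAt.mvfderiv]
    · simp only [modelWithCornersSelf_coe, Set.range_id, fderivWithin_univ]
      rfl
    · exact (hξ Z hZ).contMDiffAt.mdifferentiableAt (by simp)
  have hx : φ.symm (φ x) = x := extChartAt_to_inv x
  have hlocx : ∀ Z : Π x : M, TangentSpace 𝓘(ℝ, EM) x, loc Z (φ x) = Z x := by
    intro Z
    have h2 : loc Z (φ x) = B.inverse (Z (φ.symm (φ x))) := by
      simp only [loc, mpullbackWithin_apply, modelWithCornersSelf_coe, Set.range_id,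
        mfderivWithin_univ]
      rfl
    rw [h2, hB, ContinuousLinearMap.inverse_id]
    exact congrArg (fun y => (Z y : EM)) hx
  have hbr : (mlieBracket 𝓘(ℝ, EM) Y V x : EM) = lieBracket ℝ (loc Y) (loc V) (φ x) := by
    have h2 : (mlieBracket 𝓘(ℝ, EM) Y V x : EM) =
        A.inverse (lieBracketWithin ℝ (V := loc Y) (loc V)
          (φ.symm ⁻¹' Set.univ ∩ Set.range 𝓘(ℝ, EM)) (φ x)) := rfl
    rw [h2, hA, ContinuousLinearMap.inverse_id]
    simp only [modelWithCornersSelf_coe, Set.range_id, Set.preimage_univ, Set.inter_self,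
      lieBracketWithin_univ]
    rfl
  have hmf : ∀ v : EM, α (φ x) v = (ξ x : EM →L[ℝ] ℝ) v := by
    intro v
    have h2 : α (φ x) v = (ξ (φ.symm (φ x)) : EM →L[ℝ] ℝ) (B v) := rfl
    rw [h2, hB]
    exact congrArg (fun y => (ξ y : EM →L[ℝ] ℝ) v) hx
  have hα : DifferentiableAt ℝ α (φ x) := hξ.differentiableAt_chart x
  let θ : EM → EM [⋀^Fin 1]→L[ℝ] ℝ := fun e =>
    ContinuousAlternatingMap.ofSubsingletonLIE (0 : Fin 1) (α e)
  have hθ : DifferentiableAt ℝ θ (φ x) :=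
    (LinearIsometryEquiv.differentiableAt _).comp _ hα
  have h1 : iD ξ x (Y x) (V x) = extDeriv θ (φ x) (fun i => ![loc Y, loc V] i (φ x)) := by
    have : (fun i => ![loc Y, loc V] i (φ x)) = fun i => mfderiv 𝓘(ℝ, EM) 𝓘(ℝ, EM) φ x
      (Function.update ![Y x, 0] 1 (V x) i) := by
      ext i
      fin_cases i
      · exact (hlocx Y).trans (DFunLike.congr_fun hA (Y x)).symm
      · exact (hlocx V).trans (DFunLike.congr_fun hA (V x)).symm
    rw [this]
    rfl
  have h2 := extDeriv_apply_vectorField (V := ![loc Y, loc V]) hθ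
    (by intro i; fin_cases i <;> simp [hloc, hY, hV])
  rw [h1, h2]
  have e0 : ∀ (i : Fin 2) (e : EM), θ e (i.removeNth fun j => ![loc Y, loc V] j e)
      = α e (loc (![V, Y] i) e) := by
    intro i e
    fin_cases i <;> rfl
  simp only [e0]
  have e1 : ∑ i : Fin (0 + 1), ∑ j ≥ i, (-1) ^ (i + j : ℕ) • θ (φ x) (Matrix.vecCons
      (lieBracket ℝ (![loc Y, loc V] i.castSucc) (![loc Y, loc V] j.succ) (φ x))
      (j.removeNth <| i.castSucc.removeNth fun k => ![loc Y, loc V] k (φ x)))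
      = ξ x (mlieBracket 𝓘(ℝ, EM) Y V x) := by
    have e2 : ∀ f : Fin (0 + 1) → Fin (0 + 1) → ℝ, ∑ i, ∑ j ≥ i, f i j = f 0 0 :=
      fun f => by
        rw [Fin.sum_univ_one]
        exact Finset.sum_eq_single 0 (fun b _ hb => absurd (Fin.fin_one_eq_zero b) hb) (by simp)
    rw [e2]
    simp only [Fin.val_zero, add_zero, pow_zero, one_smul]
    exact (hmf (lieBracket ℝ (loc Y) (loc V) (φ x))).trans
      (congrArg (ξ x : EM →L[ℝ] ℝ) hbr.symm)
  rw [e1, Fin.sum_univ_two]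
  simp only [Fin.val_zero, Fin.val_one, pow_zero, pow_one, one_smul, neg_smul, ← sub_eq_add_neg]
  congr 2
  · exact (congrArg _ (hlocx Y)).trans (hder V hV _)
  · exact (congrArg _ (hlocx V)).trans (hder Y hY _)

end

/-! ### Complex multilinear extensions -/

namespace Cx

theorem map₂_add_left {A B C : Type*} [AddCommGroup A] [AddCommGroup C] {f : A → B → C}
    (h : ∀ a a' b, f (a + a') b = f a b + f a' b) (a a' : Cx A) (b : Cx B) :
    map₂ f (a + a') b = map₂ f a b + map₂ f a' b := by
  ext <;> simp only [map₂, add_re, add_im, h] <;> abel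

theorem map₂_add_right {A B C : Type*} [AddCommGroup B] [AddCommGroup C] {f : A → B → C}
    (h : ∀ a b b', f a (b + b') = f a b + f a b') (a : Cx A) (b b' : Cx B) :
    map₂ f a (b + b') = map₂ f a b + map₂ f a b' := by
  ext <;> simp only [map₂, add_re, add_im, h] <;> abel

theorem form₂_add_left {A B : Type*} [AddCommGroup A] {f : A → B → ℝ}
    (h : ∀ a a' b, f (a + a') b = f a b + f a' b) (a a' : Cx A) (b : Cx B) :
    form₂ f (a + a') b = form₂ f a b + form₂ f a' b := by
  apply Complex.ext <;> simp only [form₂, add_re, add_im, h, Complex.add_re, Complex.add_im] <;>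
    ring

theorem form₂_add_right {A B : Type*} [AddCommGroup B] {f : A → B → ℝ}
    (h : ∀ a b b', f a (b + b') = f a b + f a b') (a : Cx A) (b b' : Cx B) :
    form₂ f a (b + b') = form₂ f a b + form₂ f a b' := by
  apply Complex.ext <;> simp only [form₂, add_re, add_im, h, Complex.add_re, Complex.add_im] <;>
    ring

theorem form₂_smul_left {A B : Type*} [AddCommGroup A] [Module ℝ A] {f : A → B → ℝ}
    (h : ∀ a a' b, f (a - a') b = f a b - f a' b) (h₀ : ∀ a a' b, f (a + a') b = f a b + f a' b)
    (h' : ∀ (c : ℝ) a b, f (c • a) b = c * f a b)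
    (z : ℂ) (a : Cx A) (b : Cx B) :
    form₂ f (z • a) b = z * form₂ f a b := by
  apply Complex.ext <;>
    simp only [form₂, smul_re, smul_im, h, h', h₀, Complex.mul_re, Complex.mul_im] <;> ring

theorem form₂_smul_right {A B : Type*} [AddCommGroup B] [Module ℝ B] {f : A → B → ℝ}
    (h : ∀ a b b', f a (b - b') = f a b - f a b') (h₀ : ∀ a b b', f a (b + b') = f a b + f a b')
    (h' : ∀ (c : ℝ) a b, f a (c • b) = c * f a b)
    (z : ℂ) (a : Cx A) (b : Cx B) :
    form₂ f a (z • b) = z * form₂ f a b := by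
  apply Complex.ext <;>
    simp only [form₂, smul_re, smul_im, h, h', h₀, Complex.mul_re, Complex.mul_im] <;> ring

end Cx

/-! ### Complex covectors, derivatives and Lie brackets -/

section

variable {EM : Type*} [NormedAddCommGroup EM] [NormedSpace ℝ EM]
  {M : Type*} [TopologicalSpace M] [ChartedSpace EM M]

/-- The value `ξ(X)` of a complex covector on a complex tangent vector. -/
def cEv {x : M} (ξ : Cx (TangentSpace 𝓘(ℝ, EM) x →L[ℝ] ℝ)) (X : Cx (TangentSpace 𝓘(ℝ, EM) x)) :
    ℂ :=
  Cx.form₂ (fun α v => α v) ξ X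

theorem cEv_add_left {x : M} (ξ η : Cx (TangentSpace 𝓘(ℝ, EM) x →L[ℝ] ℝ))
    (X : Cx (TangentSpace 𝓘(ℝ, EM) x)) : cEv (ξ + η) X = cEv ξ X + cEv η X :=
  Cx.form₂_add_left (by simp) ξ η X

theorem cEv_add_right {x : M} (ξ : Cx (TangentSpace 𝓘(ℝ, EM) x →L[ℝ] ℝ))
    (X Y : Cx (TangentSpace 𝓘(ℝ, EM) x)) : cEv ξ (X + Y) = cEv ξ X + cEv ξ Y :=
  Cx.form₂_add_right (by simp) ξ X Y

theorem cEv_smul_left {x : M} (z : ℂ) (ξ : Cx (TangentSpace 𝓘(ℝ, EM) x →L[ℝ] ℝ))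
    (X : Cx (TangentSpace 𝓘(ℝ, EM) x)) : cEv (z • ξ) X = z * cEv ξ X :=
  Cx.form₂_smul_left (by simp) (by simp) (by simp) z ξ X

theorem cEv_smul_right {x : M} (z : ℂ) (ξ : Cx (TangentSpace 𝓘(ℝ, EM) x →L[ℝ] ℝ))
    (X : Cx (TangentSpace 𝓘(ℝ, EM) x)) : cEv ξ (z • X) = z * cEv ξ X :=
  Cx.form₂_smul_right (by simp) (by simp) (by simp) z ξ X

theorem mvfderiv_re {f : M → ℂ} {x : M} (hf : MDifferentiableAt 𝓘(ℝ, EM) 𝓘(ℝ, ℂ) f x)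
    (v : TangentSpace 𝓘(ℝ, EM) x) :
    mvfderiv 𝓘(ℝ, EM) (fun y => (f y).re) x v = (mvfderiv 𝓘(ℝ, EM) f x v).re := by
  have h := mfderiv_comp_apply x (Complex.reCLM.mdifferentiableAt (x := f x)) hf v
  rw [ContinuousLinearMap.mfderiv_eq] at h
  exact h

theorem mvfderiv_im {f : M → ℂ} {x : M} (hf : MDifferentiableAt 𝓘(ℝ, EM) 𝓘(ℝ, ℂ) f x)
    (v : TangentSpace 𝓘(ℝ, EM) x) :
    mvfderiv 𝓘(ℝ, EM) (fun y => (f y).im) x v = (mvfderiv 𝓘(ℝ, EM) f x v).im := by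
  have h := mfderiv_comp_apply x (Complex.imCLM.mdifferentiableAt (x := f x)) hf v
  rw [ContinuousLinearMap.mfderiv_eq] at h
  exact h

theorem contMDiff_complex_mk {f g : M → ℝ} (hf : ContMDiff 𝓘(ℝ, EM) 𝓘(ℝ, ℝ) ∞ f)
    (hg : ContMDiff 𝓘(ℝ, EM) 𝓘(ℝ, ℝ) ∞ g) :
    ContMDiff 𝓘(ℝ, EM) 𝓘(ℝ, ℂ) ∞ (fun x => (⟨f x, g x⟩ : ℂ)) := by
  exact Complex.equivRealProdCLM.symm.contDiff.contMDiff.comp (hf.prodMk_space hg)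

theorem contMDiff_complex_const_mul {f : M → ℂ} (c : ℝ) (hf : ContMDiff 𝓘(ℝ, EM) 𝓘(ℝ, ℂ) ∞ f) :
    ContMDiff 𝓘(ℝ, EM) 𝓘(ℝ, ℂ) ∞ (fun x => c * f x) :=
  ((c : ℂ) • ContinuousLinearMap.id ℝ ℂ).contDiff.contMDiff.comp hf

theorem cDer_re {f : M → ℂ} {x : M} (hf : ContMDiff 𝓘(ℝ, EM) 𝓘(ℝ, ℂ) ∞ f)
    (X : Π x : M, Cx (TangentSpace 𝓘(ℝ, EM) x)) :
    (cDer X f x).re = mvfderiv 𝓘(ℝ, EM) (fun y => (f y).re) x (X x).re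
      - mvfderiv 𝓘(ℝ, EM) (fun y => (f y).im) x (X x).im := by
  have hd := hf.contMDiffAt.mdifferentiableAt (x := x) (by simp)
  rw [mvfderiv_re hd, mvfderiv_im hd]
  simp [cDer, sub_eq_add_neg]

theorem cDer_im {f : M → ℂ} {x : M} (hf : ContMDiff 𝓘(ℝ, EM) 𝓘(ℝ, ℂ) ∞ f)
    (X : Π x : M, Cx (TangentSpace 𝓘(ℝ, EM) x)) :
    (cDer X f x).im = mvfderiv 𝓘(ℝ, EM) (fun y => (f y).im) x (X x).re
      + mvfderiv 𝓘(ℝ, EM) (fun y => (f y).re) x (X x).im := by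
  have hd := hf.contMDiffAt.mdifferentiableAt (x := x) (by simp)
  rw [mvfderiv_re hd, mvfderiv_im hd]
  simp [cDer]

theorem cDer_add {f g : M → ℂ} {x : M} (hf : ContMDiff 𝓘(ℝ, EM) 𝓘(ℝ, ℂ) ∞ f)
    (hg : ContMDiff 𝓘(ℝ, EM) 𝓘(ℝ, ℂ) ∞ g) (X : Π x : M, Cx (TangentSpace 𝓘(ℝ, EM) x)) :
    cDer X (fun y => f y + g y) x = cDer X f x + cDer X g x := by
  have hf' := hf.contMDiffAt.mdifferentiableAt (x := x) (by simp)
  have hg' := hg.contMDiffAt.mdifferentiableAt (x := x) (by simp)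
  simp only [cDer, mvfderiv_fun_add hf' hg', add_apply]
  ring

theorem cDer_const_mul {f : M → ℂ} {x : M} (hf : ContMDiff 𝓘(ℝ, EM) 𝓘(ℝ, ℂ) ∞ f) (c : ℝ)
    (X : Π x : M, Cx (TangentSpace 𝓘(ℝ, EM) x)) :
    cDer X (fun y => c * f y) x = c * cDer X f x := by
  have hf' := hf.contMDiffAt.mdifferentiableAt (x := x) (by simp)
  have h : mvfderiv 𝓘(ℝ, EM) (fun y => (c : ℂ) * f y) x = c • mvfderiv 𝓘(ℝ, EM) f x := by
    have := mvfderiv_fun_smul (I := 𝓘(ℝ, EM)) (a := fun _ : M => c) (x := x)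
      mdifferentiableAt_const hf'
    simpa [mvfderiv_const] using this
  simp only [cDer, h, smul_apply, Complex.real_smul]
  ring

theorem cLie_swap (X Y : Π x : M, Cx (TangentSpace 𝓘(ℝ, EM) x)) (x : M) :
    cLie X Y x = -cLie Y X x := by
  ext
  · simp only [cLie, Cx.neg_re]
    rw [mlieBracket_swap_apply (V := fun y => (X y).re), mlieBracket_swap_apply
      (V := fun y => (X y).im)]
    abel
  · simp only [cLie, Cx.neg_im]
    rw [mlieBracket_swap_apply (V := fun y => (X y).re), mlieBracket_swap_apply
      (V := fun y => (X y).im)]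
    abel

variable [IsManifold 𝓘(ℝ, EM) ∞ M]

/-- A complex 1-form is smooth if its real and imaginary parts are. -/
def SmoothCOneForm (ξ : Π x : M, Cx (TangentSpace 𝓘(ℝ, EM) x →L[ℝ] ℝ)) : Prop :=
  SmoothOneForm (fun x => (ξ x).re) ∧ SmoothOneForm (fun x => (ξ x).im)

theorem SmoothCOneForm.cEv {ξ : Π x : M, Cx (TangentSpace 𝓘(ℝ, EM) x →L[ℝ] ℝ)}
    (hξ : SmoothCOneForm ξ) {X : Π x : M, Cx (TangentSpace 𝓘(ℝ, EM) x)}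
    (hX : SmoothCSec EM EM X) :
    ContMDiff 𝓘(ℝ, EM) 𝓘(ℝ, ℂ) ∞ (fun x => cEv (ξ x) (X x)) :=
  contMDiff_complex_mk ((hξ.1 _ hX.1).sub (hξ.2 _ hX.2)) ((hξ.1 _ hX.2).add (hξ.2 _ hX.1))

/-- The derivative `X(ξ(Z))` is the complex trilinear extension of its real counterpart. -/
theorem cDer_cEv {ξ : Π x : M, Cx (TangentSpace 𝓘(ℝ, EM) x →L[ℝ] ℝ)}
    (hξ : SmoothCOneForm ξ) {Z : Π x : M, Cx (TangentSpace 𝓘(ℝ, EM) x)}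
    (hZ : SmoothCSec EM EM Z) (X : Π x : M, Cx (TangentSpace 𝓘(ℝ, EM) x)) (x : M) :
    cDer X (fun y => cEv (ξ y) (Z y)) x =
      Cx.form₃ (fun (v : TangentSpace 𝓘(ℝ, EM) x) (α : Π y : M, TangentSpace 𝓘(ℝ, EM) y →L[ℝ] ℝ)
        (Z : Π y : M, TangentSpace 𝓘(ℝ, EM) y) => mvfderiv 𝓘(ℝ, EM) (fun y => α y (Z y)) x v)
        (X x) ⟨fun y => (ξ y).re, fun y => (ξ y).im⟩ ⟨fun y => (Z y).re, fun y => (Z y).im⟩ := by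
  have d11 := ((hξ.1 _ hZ.1).contMDiffAt (x := x)).mdifferentiableAt (by simp)
  have d12 := ((hξ.1 _ hZ.2).contMDiffAt (x := x)).mdifferentiableAt (by simp)
  have d21 := ((hξ.2 _ hZ.1).contMDiffAt (x := x)).mdifferentiableAt (by simp)
  have d22 := ((hξ.2 _ hZ.2).contMDiffAt (x := x)).mdifferentiableAt (by simp)
  apply Complex.ext
  · rw [cDer_re (hξ.cEv hZ)]
    simp only [cEv, Cx.form₂, Cx.form₃]
    rw [mvfderiv_fun_sub d11 d22, mvfderiv_fun_add d12 d21]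
    simp only [add_apply, sub_apply]
    ring
  · rw [cDer_im (hξ.cEv hZ)]
    simp only [cEv, Cx.form₂, Cx.form₃]
    rw [mvfderiv_fun_sub d11 d22, mvfderiv_fun_add d12 d21]
    simp only [add_apply, sub_apply]
    ring

end

/-! ### The complexified Courant algebroid -/

namespace StandardCourant

variable {EM : Type*} [NormedAddCommGroup EM] [NormedSpace ℝ EM]
  {M : Type*} [TopologicalSpace M] [ChartedSpace EM M] [IsManifold 𝓘(ℝ, EM) ∞ M]
  {F : Type*} [NormedAddCommGroup F] [NormedSpace ℝ F]
  {G : M → Type*} [TopologicalSpace (TotalSpace F G)]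
  [∀ x, AddCommGroup (G x)] [∀ x, Module ℝ (G x)] [∀ x, TopologicalSpace (G x)]
  [∀ x, IsTopologicalAddGroup (G x)] [∀ x, ContinuousSMul ℝ (G x)]
  [FiberBundle F G] [VectorBundle ℝ F G]
  (C : StandardCourant EM F G)

section Algebra

variable (x : M) (r s t : Cx (G x))

theorem cIp_symm : C.cIp x r s = C.cIp x s r := by
  apply Complex.ext <;> simp only [cIp, Cx.form₂, C.ip_symm x s.re, C.ip_symm x s.im]
  ring

theorem cIp_add_left : C.cIp x (r + s) t = C.cIp x r t + C.cIp x s t :=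
  Cx.form₂_add_left (by simp) r s t

theorem cIp_add_right : C.cIp x r (s + t) = C.cIp x r s + C.cIp x r t :=
  Cx.form₂_add_right (by simp) r s t

theorem cIp_smul_left (z : ℂ) : C.cIp x (z • r) t = z * C.cIp x r t :=
  Cx.form₂_smul_left (by simp) (by simp) (by simp) z r t

theorem cIp_smul_right (z : ℂ) : C.cIp x r (z • t) = z * C.cIp x r t :=
  Cx.form₂_smul_right (by simp) (by simp) (by simp) z r t

theorem cIp_neg_left : C.cIp x (-r) t = -C.cIp x r t := by
  simpa using C.cIp_smul_left x r t (-1)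

theorem cIp_neg_right : C.cIp x r (-t) = -C.cIp x r t := by
  simpa using C.cIp_smul_right x r t (-1)

theorem cIp_sub_left : C.cIp x (r - s) t = C.cIp x r t - C.cIp x s t := by
  rw [sub_eq_add_neg, cIp_add_left, cIp_neg_left, sub_eq_add_neg]

theorem cIp_sub_right : C.cIp x r (s - t) = C.cIp x r s - C.cIp x r t := by
  rw [sub_eq_add_neg, cIp_add_right, cIp_neg_right, sub_eq_add_neg]

theorem cBr_add_left : C.cBr x (r + s) t = C.cBr x r t + C.cBr x s t :=
  Cx.map₂_add_left (by simp) r s t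

theorem cBr_add_right : C.cBr x r (s + t) = C.cBr x r s + C.cBr x r t :=
  Cx.map₂_add_right (by simp) r s t

theorem br_swap (a b : G x) : C.br x a b = -C.br x b a := by
  have h := C.br_self x (a + b)
  simp only [map_add, add_apply, C.br_self, zero_add, add_zero] at h
  exact eq_neg_of_add_eq_zero_right h

theorem cBr_swap : C.cBr x r s = -C.cBr x s r := by
  ext <;> simp only [cBr, Cx.map₂, Cx.neg_re, Cx.neg_im, C.br_swap x s.re, C.br_swap x s.im] <;>
    abel

theorem cBr_zero_left : C.cBr x 0 s = 0 := by
  ext <;> simp [cBr, Cx.map₂]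

theorem cIp_zero_right : C.cIp x r 0 = 0 := by
  apply Complex.ext <;> simp [cIp, Cx.form₂]

theorem cIp_cBr_left : C.cIp x (C.cBr x r s) t = -C.cIp x s (C.cBr x r t) := by
  have h : ∀ a b c, C.ip x (C.br x a b) c = -C.ip x b (C.br x a c) := fun a b c =>
    eq_neg_of_add_eq_zero_left (C.ip_invariant x a b c)
  apply Complex.ext <;>
    simp only [cIp, cBr, Cx.map₂, Cx.form₂, map_sub, map_add, sub_apply,
      add_apply, h, Complex.neg_re, Complex.neg_im] <;> ring

theorem cR_swap (X Y : Cx (TangentSpace 𝓘(ℝ, EM) x)) : C.cR x X Y = -C.cR x Y X := by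
  have h : ∀ a b, C.R x ![a, b] = -C.R x ![b, a] := by
    intro a b
    have := (C.R x).map_swap ![b, a] (i := 0) (j := 1) (by simp)
    refine Eq.trans (congrArg (C.R x) ?_) this
    ext i
    fin_cases i <;> rfl
  ext <;> simp only [cR, Cx.map₂, Cx.neg_re, Cx.neg_im, h Y.re, h Y.im] <;> abel

end Algebra

section Calculus

variable {X : Π x : M, Cx (TangentSpace 𝓘(ℝ, EM) x)} {r s : Π x : M, Cx (G x)}

theorem contMDiff_cIp (hr : SmoothCSec EM F r) (hs : SmoothCSec EM F s) :
    ContMDiff 𝓘(ℝ, EM) 𝓘(ℝ, ℂ) ∞ (fun x => C.cIp x (r x) (s x)) :=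
  contMDiff_complex_mk ((C.ip_smooth _ _ hr.1 hs.1).sub (C.ip_smooth _ _ hr.2 hs.2))
    ((C.ip_smooth _ _ hr.1 hs.2).add (C.ip_smooth _ _ hr.2 hs.1))

/-- The complexified connection is compatible with the scalar product. -/
theorem cDer_cIp (hr : SmoothCSec EM F r) (hs : SmoothCSec EM F s)
    (X : Π x : M, Cx (TangentSpace 𝓘(ℝ, EM) x)) (x : M) :
    cDer X (fun y => C.cIp y (r y) (s y)) x =
      C.cIp x (C.cNabla X r x) (s x) + C.cIp x (r x) (C.cNabla X s x) := by
  have d11 := ((C.ip_smooth _ _ hr.1 hs.1).contMDiffAt (x := x)).mdifferentiableAt (by simp)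
  have d12 := ((C.ip_smooth _ _ hr.1 hs.2).contMDiffAt (x := x)).mdifferentiableAt (by simp)
  have d21 := ((C.ip_smooth _ _ hr.2 hs.1).contMDiffAt (x := x)).mdifferentiableAt (by simp)
  have d22 := ((C.ip_smooth _ _ hr.2 hs.2).contMDiffAt (x := x)).mdifferentiableAt (by simp)
  apply Complex.ext
  · rw [cDer_re (C.contMDiff_cIp hr hs)]
    simp only [cIp, Cx.form₂, cNabla]
    rw [mvfderiv_fun_sub d11 d22, mvfderiv_fun_add d12 d21]
    simp only [add_apply, sub_apply, map_add, map_sub,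
      C.nabla_ip _ _ hr.1 hs.1, C.nabla_ip _ _ hr.1 hs.2, C.nabla_ip _ _ hr.2 hs.1,
      C.nabla_ip _ _ hr.2 hs.2, Complex.add_re]
    ring
  · rw [cDer_im (C.contMDiff_cIp hr hs)]
    simp only [cIp, Cx.form₂, cNabla]
    rw [mvfderiv_fun_sub d11 d22, mvfderiv_fun_add d12 d21]
    simp only [add_apply, sub_apply, map_add, map_sub,
      C.nabla_ip _ _ hr.1 hs.1, C.nabla_ip _ _ hr.1 hs.2, C.nabla_ip _ _ hr.2 hs.1,
      C.nabla_ip _ _ hr.2 hs.2, Complex.add_im]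
    ring

theorem cNabla_add (hr : SmoothCSec EM F r) (hs : SmoothCSec EM F s)
    (X : Π x : M, Cx (TangentSpace 𝓘(ℝ, EM) x)) (x : M) :
    C.cNabla X (fun y => r y + s y) x = C.cNabla X r x + C.cNabla X s x := by
  have h : ∀ a b : Π x, G x, SmoothSec EM F a → SmoothSec EM F b →
      C.nabla (fun y => a y + b y) x = C.nabla a x + C.nabla b x := fun a b ha hb =>
    C.nabla.isCovariantDerivativeOnUniv.add
      (ha.contMDiffAt.mdifferentiableAt (by simp)) (hb.contMDiffAt.mdifferentiableAt (by simp))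
  ext <;>
    simp only [cNabla, Cx.add_re, Cx.add_im, h _ _ hr.1 hs.1, h _ _ hr.2 hs.2,
      add_apply] <;> abel

end Calculus

/-- The component of an element of `E^ℂ` in `(TM)^ℂ`. -/
def tPart {x : M} (u : Cx (Fib EM G x)) : Cx (TangentSpace 𝓘(ℝ, EM) x) := ⟨u.re.1, u.im.1⟩

/-- The component of an element of `E^ℂ` in `(T*M)^ℂ`. -/
def cPart {x : M} (u : Cx (Fib EM G x)) : Cx (TangentSpace 𝓘(ℝ, EM) x →L[ℝ] ℝ) :=
  ⟨u.re.2.1, u.im.2.1⟩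

/-- The component of an element of `E^ℂ` in `G^ℂ`. -/
def gPart {x : M} (u : Cx (Fib EM G x)) : Cx (G x) := ⟨u.re.2.2, u.im.2.2⟩

theorem tPart_cDorfman (u v : Π x : M, Cx (Fib EM G x)) (x : M) :
    tPart (C.cDorfman u v x) = cLie (fun y => tPart (u y)) (fun y => tPart (v y)) x := rfl

theorem gPart_cDorfman (u v : Π x : M, Cx (Fib EM G x)) (x : M) :
    gPart (C.cDorfman u v x) = C.cR x (tPart (u x)) (tPart (v x))
      + C.cNabla (fun y => tPart (u y)) (fun y => gPart (v y)) x
      - C.cNabla (fun y => tPart (v y)) (fun y => gPart (u y)) x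
      + C.cBr x (gPart (u x)) (gPart (v x)) := by
  ext <;>
    simp only [gPart, cDorfman, dorfman, cR, cNabla, cBr, tPart, Cx.map₂, Cx.add_re, Cx.sub_re,
      Cx.add_im, Cx.sub_im, Prod.snd_sub, Prod.snd_add] <;> abel

variable [FiniteDimensional ℝ EM] [T2Space M]

/-- The covector part of the Dorfman bracket, evaluated on a vector field, with the Lie derivative
and the differential resolved into derivatives of functions and Lie brackets. In this form all terms
are additive in each section, so that the complex extension can be read off. -/
theorem dorfman_cotangent_apply {u v : Π x : M, Fib EM G x} (hu : SmoothE F u) (hv : SmoothE F v)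
    {Z : Π x : M, TangentSpace 𝓘(ℝ, EM) x} (hZ : SmoothSec EM EM Z) (x : M) :
    (C.dorfman u v x).2.1 (Z x) =
      C.H x ![(u x).1, (v x).1, Z x]
      + mvfderiv 𝓘(ℝ, EM) (fun y => (v y).2.1 (Z y)) x (u x).1
      - (v x).2.1 (mlieBracket 𝓘(ℝ, EM) (fun y => (u y).1) Z x)
      - mvfderiv 𝓘(ℝ, EM) (fun y => (u y).2.1 (Z y)) x (v x).1
      + mvfderiv 𝓘(ℝ, EM) (fun y => (u y).2.1 (v y).1) x (Z x)
      + (u x).2.1 (mlieBracket 𝓘(ℝ, EM) (fun y => (v y).1) Z x)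
      - 2 * C.ip x (v x).2.2 (C.R x ![(u x).1, Z x])
      + 2 * C.ip x (u x).2.2 (C.R x ![(v x).1, Z x])
      + 2 * C.ip x (v x).2.2 (C.nabla (fun y => (u y).2.2) x (Z x)) := by
  have h3 : ∀ a b : TangentSpace 𝓘(ℝ, EM) x,
      (C.H x).toContinuousLinearMap ![a, b, 0] 2 (Z x) = C.H x ![a, b, Z x] := by
    intro a b
    refine congrArg (C.H x) ?_
    ext i
    fin_cases i <;> rfl
  have h2 : ∀ a : TangentSpace 𝓘(ℝ, EM) x,
      (C.R x).toContinuousLinearMap ![a, 0] 1 (Z x) = C.R x ![a, Z x] := by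
    intro a
    refine congrArg (C.R x) ?_
    ext i
    fin_cases i <;> rfl
  simp only [dorfman, lieD, add_apply, sub_apply,
    smul_apply, ContinuousLinearMap.comp_apply, smul_eq_mul, h3, h2]
  rw [iD_apply hv.2.1 hu.1 hZ, iD_apply hu.2.1 hv.1 hZ]
  ring

/-- The complex multilinear extension of `dorfman_cotangent_apply`. -/
theorem cEv_cPart_cDorfman {u v : Π x : M, Cx (Fib EM G x)}
    (hu : SmoothE F (fun x => (u x).re)) (hu' : SmoothE F (fun x => (u x).im))
    (hv : SmoothE F (fun x => (v x).re)) (hv' : SmoothE F (fun x => (v x).im))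
    {Z : Π x : M, Cx (TangentSpace 𝓘(ℝ, EM) x)} (hZ : SmoothCSec EM EM Z) (x : M) :
    cEv (cPart (C.cDorfman u v x)) (Z x) =
      C.cH x (tPart (u x)) (tPart (v x)) (Z x)
      + cDer (fun y => tPart (u y)) (fun y => cEv (cPart (v y)) (Z y)) x
      - cEv (cPart (v x)) (cLie (fun y => tPart (u y)) Z x)
      - cDer (fun y => tPart (v y)) (fun y => cEv (cPart (u y)) (Z y)) x
      + cDer Z (fun y => cEv (cPart (u y)) (tPart (v y))) x
      + cEv (cPart (u x)) (cLie (fun y => tPart (v y)) Z x)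
      - 2 * C.cIp x (gPart (v x)) (C.cR x (tPart (u x)) (Z x))
      + 2 * C.cIp x (gPart (u x)) (C.cR x (tPart (v x)) (Z x))
      + 2 * C.cIp x (gPart (v x)) (C.cNabla Z (fun y => gPart (u y)) x) := by
  have hcu : SmoothCOneForm (fun y => cPart (u y)) := ⟨hu.2.1, hu'.2.1⟩
  have hcv : SmoothCOneForm (fun y => cPart (v y)) := ⟨hv.2.1, hv'.2.1⟩
  have htv : SmoothCSec EM EM (fun y => tPart (v y)) := ⟨hv.1, hv'.1⟩
  rw [cDer_cEv hcv hZ, cDer_cEv hcu hZ, cDer_cEv hcu htv]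
  -- The indices refer to the real (1) or imaginary (2) parts of `u`, `v` and `Z`.
  have e111 := C.dorfman_cotangent_apply hu hv hZ.1 x
  have e112 := C.dorfman_cotangent_apply hu hv hZ.2 x
  have e121 := C.dorfman_cotangent_apply hu hv' hZ.1 x
  have e122 := C.dorfman_cotangent_apply hu hv' hZ.2 x
  have e211 := C.dorfman_cotangent_apply hu' hv hZ.1 x
  have e212 := C.dorfman_cotangent_apply hu' hv hZ.2 x
  have e221 := C.dorfman_cotangent_apply hu' hv' hZ.1 x
  have e222 := C.dorfman_cotangent_apply hu' hv' hZ.2 x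
  apply Complex.ext
  · simp only [cEv, cPart, cDorfman, cH, cLie, cIp, cR, cNabla, tPart, gPart, Cx.form₂, Cx.form₃,
      Cx.map₂, Prod.snd_sub, Prod.snd_add, Prod.fst_sub, Prod.fst_add,
      add_apply, sub_apply, map_add, map_sub,
      Complex.add_re, Complex.sub_re, Complex.mul_re, Complex.re_ofNat, Complex.im_ofNat]
    linear_combination e111 - e221 - e122 - e212
  · simp only [cEv, cPart, cDorfman, cH, cLie, cIp, cR, cNabla, tPart, gPart, Cx.form₂, Cx.form₃,
      Cx.map₂, Prod.snd_sub, Prod.snd_add, Prod.fst_sub, Prod.fst_add,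
      add_apply, sub_apply, map_add, map_sub,
      Complex.add_im, Complex.sub_im, Complex.mul_im, Complex.re_ofNat, Complex.im_ofNat]
    linear_combination e112 - e222 + e121 + e211

end StandardCourant

/-! ### Extension of complex covectors -/

namespace Cx

variable {V : Type*} [AddCommGroup V]

theorem sum_re {ι : Type*} (t : Finset ι) (f : ι → Cx V) : (∑ i ∈ t, f i).re = ∑ i ∈ t, (f i).re :=
  map_sum (AddMonoidHom.mk' (fun a : Cx V => a.re) add_re) f t

theorem sum_im {ι : Type*} (t : Finset ι) (f : ι → Cx V) : (∑ i ∈ t, f i).im = ∑ i ∈ t, (f i).im :=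
  map_sum (AddMonoidHom.mk' (fun a : Cx V => a.im) add_im) f t

instance [Module ℝ V] [FiniteDimensional ℝ V] : FiniteDimensional ℂ (Cx V) := by
  let b := Module.finBasis ℝ V
  refine Module.Finite.of_surjective
    (Fintype.linearCombination ℂ (fun i => (⟨b i, 0⟩ : Cx V))) fun a => ?_
  refine ⟨fun i => ⟨b.repr a.re i, b.repr a.im i⟩, ?_⟩
  rw [Fintype.linearCombination_apply]
  ext <;> simp [sum_re, sum_im, b.sum_repr]

end Cx

section Covector

variable {EM : Type*} [NormedAddCommGroup EM] [NormedSpace ℝ EM]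
  {M : Type*} [TopologicalSpace M] [ChartedSpace EM M]

theorem cEv_sum_left {ι : Type*} {x : M} (t : Finset ι)
    (ξ : ι → Cx (TangentSpace 𝓘(ℝ, EM) x →L[ℝ] ℝ)) (X : Cx (TangentSpace 𝓘(ℝ, EM) x)) :
    cEv (∑ i ∈ t, ξ i) X = ∑ i ∈ t, cEv (ξ i) X := by
  let f : Cx (TangentSpace 𝓘(ℝ, EM) x →L[ℝ] ℝ) →+ ℂ :=
    AddMonoidHom.mk' (fun ξ => cEv ξ X) fun ξ η => cEv_add_left ξ η X
  exact map_sum f ξ t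

/-- A complex covector as a complex linear functional on the complexified tangent space. -/
def cEvLin {x : M} (ξ : Cx (TangentSpace 𝓘(ℝ, EM) x →L[ℝ] ℝ)) :
    Cx (TangentSpace 𝓘(ℝ, EM) x) →ₗ[ℂ] ℂ where
  toFun := cEv ξ
  map_add' := cEv_add_right ξ
  map_smul' z X := cEv_smul_right z ξ X

variable [FiniteDimensional ℝ EM]

theorem exists_covector_extension {x : M} (W : Submodule ℂ (Cx (TangentSpace 𝓘(ℝ, EM) x)))
    (β : W →ₗ[ℂ] ℂ) :
    ∃ ξ : Cx (TangentSpace 𝓘(ℝ, EM) x →L[ℝ] ℝ), ∀ Y : W, cEv ξ Y = β Y := by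
  obtain ⟨g, hg⟩ := β.exists_extend
  -- `g` is determined by its restriction `ι` to the real vectors.
  let ι : TangentSpace 𝓘(ℝ, EM) x →ₗ[ℝ] ℂ :=
    { toFun := fun v => g ⟨v, 0⟩
      map_add' := fun v w => by rw [← map_add]; congr 1; ext <;> simp
      map_smul' := fun c v => by
        have h : (⟨c • v, 0⟩ : Cx (TangentSpace 𝓘(ℝ, EM) x)) = (c : ℂ) • ⟨v, 0⟩ := by
          ext <;> simp [-Complex.coe_smul]
        rw [h, map_smul, Complex.coe_smul, RingHom.id_apply] }
  have : FiniteDimensional ℝ (TangentSpace 𝓘(ℝ, EM) x) := inferInstanceAs (FiniteDimensional ℝ EM)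
  have : T2Space (TangentSpace 𝓘(ℝ, EM) x) := inferInstanceAs (T2Space EM)
  refine ⟨⟨LinearMap.toContinuousLinearMap (Complex.reLm ∘ₗ ι),
    LinearMap.toContinuousLinearMap (Complex.imLm ∘ₗ ι)⟩, fun Y => ?_⟩
  have hY : β Y = g Y.1 := by rw [← hg]; rfl
  have hY' : Y.1 = ⟨Y.1.re, 0⟩ + Complex.I • ⟨Y.1.im, 0⟩ := by ext <;> simp
  rw [hY, hY', map_add, map_smul]
  apply Complex.ext <;> simp [cEv, Cx.form₂, ι, sub_eq_add_neg, add_comm]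

variable [T2Space M] [IsManifold 𝓘(ℝ, EM) ∞ M]

/-- Every covector is the value of a smooth 1-form: transport it by the trivialization of `TM` and
cut off by a bump function. -/
theorem exists_smoothOneForm_apply_eq {x₀ : M} (α : TangentSpace 𝓘(ℝ, EM) x₀ →L[ℝ] ℝ) :
    ∃ ξ : Π x : M, TangentSpace 𝓘(ℝ, EM) x →L[ℝ] ℝ, SmoothOneForm ξ ∧ ξ x₀ = α := by
  let t := trivializationAt EM (fun x : M => TangentSpace 𝓘(ℝ, EM) x) x₀
  have ht : t.baseSet = (chartAt EM x₀).source := TangentBundle.trivializationAt_baseSet x₀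
  obtain ⟨χ, -, -⟩ := (SmoothBumpFunction.nhds_basis_support (I := 𝓘(ℝ, EM))
    (Filter.univ_mem (f := 𝓝 x₀))).mem_iff.1 Filter.univ_mem
  let α' : EM →L[ℝ] ℝ := α.comp (t.symmL ℝ x₀)
  refine ⟨fun x => χ x • α'.comp (t.continuousLinearMapAt ℝ x), fun X hX => ?_, ?_⟩
  · refine χ.contMDiff_smul (g := fun x => α' (t.continuousLinearMapAt ℝ x (X x))) ?_
    rw [← ht]
    intro x hx
    have h1 : ContMDiffWithinAt 𝓘(ℝ, EM) 𝓘(ℝ, EM) ∞ (fun x => (t ⟨x, X x⟩).2) t.baseSet x :=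
      (t.contMDiffWithinAt_section _ hx).1 (hX.contMDiffAt.contMDiffWithinAt)
    have h2 := α'.contDiff (n := ∞) |>.contMDiff.contMDiffAt.comp_contMDiffWithinAt x h1
    refine h2.congr (fun y hy => ?_) ?_
    · simp [t.coe_linearMapAt_of_mem hy]
    · simp [t.coe_linearMapAt_of_mem hx]
  · have hx : x₀ ∈ t.baseSet := FiberBundle.mem_baseSet_trivializationAt' x₀
    ext v
    have h1 : t.symmL ℝ x₀ (t.continuousLinearMapAt ℝ x₀ v) = v :=
      t.symmL_continuousLinearMapAt hx v
    have h2 : χ x₀ = 1 := χ.eq_one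
    simp only [h2, one_smul]
    exact congrArg α h1

theorem exists_smoothCOneForm_apply_eq {x₀ : M} (α : Cx (TangentSpace 𝓘(ℝ, EM) x₀ →L[ℝ] ℝ)) :
    ∃ ξ : Π x : M, Cx (TangentSpace 𝓘(ℝ, EM) x →L[ℝ] ℝ), SmoothCOneForm ξ ∧ ξ x₀ = α := by
  obtain ⟨ξ, hξ, h⟩ := exists_smoothOneForm_apply_eq α.re
  obtain ⟨η, hη, h'⟩ := exists_smoothOneForm_apply_eq α.im
  exact ⟨fun x => ⟨ξ x, η x⟩, ⟨hξ, hη⟩, by ext1 <;> assumption⟩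

end Covector

/-! ### Smooth dependence of the solutions of linear systems -/

section Matrix

variable {k : ℕ}

theorem contDiff_det :
    ContDiff ℝ ∞ (fun m : Fin k → Fin k → ℂ => (Matrix.of m).det) := by
  simp only [Matrix.det_apply']
  refine ContDiff.sum fun σ _ => contDiff_const.mul (contDiff_prod fun i _ => ?_)
  simp only [Matrix.of_apply]
  fun_prop

theorem contDiff_adjugate_apply (i j : Fin k) :
    ContDiff ℝ ∞ (fun m : Fin k → Fin k → ℂ => (Matrix.of m).adjugate i j) := by
  have h : ContDiff ℝ ∞ (fun m : Fin k → Fin k → ℂ =>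
      (fun a b => (Matrix.of m).updateRow j (Pi.single i 1) a b : Fin k → Fin k → ℂ)) := by
    refine contDiff_pi.2 fun a => contDiff_pi.2 fun b => ?_
    by_cases ha : a = j
    · subst ha
      simp only [Matrix.updateRow_self]
      exact contDiff_const
    · simp only [Matrix.updateRow_ne ha, Matrix.of_apply]
      fun_prop
  simp only [Matrix.adjugate_apply]
  exact contDiff_det.comp h

theorem contDiffAt_inv_mulVec_apply {m : Fin k → Fin k → ℂ} (hm : (Matrix.of m).det ≠ 0)
    (b : Fin k → ℂ) (i : Fin k) :
    ContDiffAt ℝ ∞ (fun p : (Fin k → Fin k → ℂ) × (Fin k → ℂ) =>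
      ((Matrix.of p.1)⁻¹.mulVec p.2) i) (m, b) := by
  simp only [Matrix.mulVec, dotProduct, Matrix.inv_def, Matrix.smul_apply, smul_eq_mul,
    Ring.inverse_eq_inv']
  refine ContDiffAt.sum fun j _ => ContDiffAt.mul (ContDiffAt.mul ?_ ?_) ?_
  · exact (contDiff_det.contDiffAt.comp (m, b) contDiffAt_fst).inv hm
  · exact (contDiff_adjugate_apply i j).contDiffAt.comp (m, b) contDiffAt_fst
  · fun_prop

end Matrix

/-! ### Extension of functionals on a bundle of complex subspaces to 1-forms -/

section Frame

variable {EM : Type*} [NormedAddCommGroup EM] [NormedSpace ℝ EM] [FiniteDimensional ℝ EM]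
  {M : Type*} [TopologicalSpace M] [T2Space M] [ChartedSpace EM M] [IsManifold 𝓘(ℝ, EM) ∞ M]
  {W : Π x : M, Submodule ℂ (Cx (TangentSpace 𝓘(ℝ, EM) x))}

/-- Local form of `exists_oneForm_extension`. Choose sections `X_i` of `W` which form a basis of
`W x₀` and 1-forms `λ_j` which restrict at `x₀` to the dual basis. Near `x₀` the matrix `λ_j(X_i)`
is invertible, the rank being constant the `X_i` form a frame of `W`, and the coefficients of `ξ = ∑
j, c_j λ_j` with `ξ(X_i) = β(X_i)` are smooth by Cramer's rule. -/
theorem exists_local_oneForm_extension {k : ℕ} (hk : ∀ x, Module.finrank ℂ (W x) = k)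
    (hW : ∀ x (w : W x), ∃ Y : CSec EM EM W, Y.at x = w) (β : Π x, W x →ₗ[ℂ] ℂ)
    (hβ : ∀ Y : CSec EM EM W, ContMDiff 𝓘(ℝ, EM) 𝓘(ℝ, ℂ) ∞ (fun x => β x (Y.at x))) (x₀ : M) :
    ∃ U : Set M, IsOpen U ∧ x₀ ∈ U ∧ ∃ ξ : Π x : M, Cx (TangentSpace 𝓘(ℝ, EM) x →L[ℝ] ℝ),
      (∀ x ∈ U, ∀ Y : W x, cEv (ξ x) Y = β x Y) ∧
      ∀ Z : Π x : M, TangentSpace 𝓘(ℝ, EM) x, SmoothSec EM EM Z → ∀ x ∈ U,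
        ContMDiffAt 𝓘(ℝ, EM) 𝓘(ℝ, ℝ) ∞ (fun y => (ξ y).re (Z y)) x ∧
        ContMDiffAt 𝓘(ℝ, EM) 𝓘(ℝ, ℝ) ∞ (fun y => (ξ y).im (Z y)) x := by
  have hfin : ∀ x : M, FiniteDimensional ℂ (Cx (TangentSpace 𝓘(ℝ, EM) x)) := fun x =>
    inferInstanceAs (FiniteDimensional ℂ (Cx EM))
  let b : Module.Basis (Fin k) ℂ (W x₀) := Module.finBasisOfFinrankEq ℂ (W x₀) (hk x₀)
  choose X hX using fun i => hW x₀ (b i)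
  choose l hl using fun j => exists_covector_extension (W x₀) (b.coord j)
  choose lam hlam hlam₀ using fun j => exists_smoothCOneForm_apply_eq (l j)
  let m : M → Fin k → Fin k → ℂ := fun x i j => cEv (lam j x) ((X i).val x)
  have hm : ContMDiff 𝓘(ℝ, EM) 𝓘(ℝ, Fin k → Fin k → ℂ) ∞ m :=
    contMDiff_pi_space.2 fun i => contMDiff_pi_space.2 fun j => (hlam j).cEv (X i).smooth
  let v : M → Fin k → ℂ := fun x i => β x ((X i).at x)
  have hv : ContMDiff 𝓘(ℝ, EM) 𝓘(ℝ, Fin k → ℂ) ∞ v := contMDiff_pi_space.2 fun i => hβ (X i)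
  have hm₀ : Matrix.of (m x₀) = 1 := by
    ext i j
    have h : (X i).val x₀ = (b i : Cx (TangentSpace 𝓘(ℝ, EM) x₀)) := congrArg Subtype.val (hX i)
    simp [m, h, hlam₀, hl, Matrix.one_apply, Finsupp.single_apply]
  let c : M → Fin k → ℂ := fun x => (Matrix.of (m x))⁻¹.mulVec (v x)
  refine ⟨{x | (Matrix.of (m x)).det ≠ 0}, ?_, ?_, fun x => ∑ j, c x j • lam j x, ?_, ?_⟩
  · exact isOpen_ne.preimage (contDiff_det.continuous.comp hm.continuous)
  · simp [hm₀]
  · intro x hx Y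
    -- The `X_i` are independent because the matrix of their values under the `λ_j` is invertible.
    have hli : LinearIndependent ℂ (fun i => (X i).at x) := by
      rw [Fintype.linearIndependent_iff]
      intro g hg
      have h1 : Matrix.vecMul g (Matrix.of (m x)) = 0 := by
        ext j
        have := congrArg (fun Y : W x => cEvLin (lam j x) Y) hg
        simp only [map_sum, Submodule.coe_sum, Submodule.coe_smul, map_smul, Submodule.coe_zero,
          map_zero] at this
        exact this
      exact fun i => congrFun (Matrix.eq_zero_of_vecMul_eq_zero hx h1) i
    have hspan := hli.span_eq_top_of_card_eq_finrank' (by simp [hk])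
    have hcv : Matrix.mulVec (Matrix.of (m x)) (c x) = v x := by
      have : IsUnit (Matrix.of (m x)).det := isUnit_iff_ne_zero.2 hx
      simp [c, Matrix.mulVec_mulVec, Matrix.mul_nonsing_inv _ this]
    have heq : (cEvLin (∑ j, c x j • lam j x)) ∘ₗ (W x).subtype = β x := by
      refine LinearMap.ext_on_range hspan fun i => ?_
      have h2 := congrFun hcv i
      simp only [Matrix.mulVec, dotProduct, Matrix.of_apply, m, v] at h2
      rw [← h2]
      simp [cEvLin, cEv_sum_left, cEv_smul_left, CSec.at, mul_comm]
    exact DFunLike.congr_fun heq Y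
  · intro Z hZ x hx
    have hc : ∀ j, ContMDiffAt 𝓘(ℝ, EM) 𝓘(ℝ, ℂ) ∞ (fun y => c y j) x := by
      intro j
      have hmv : ContMDiffAt 𝓘(ℝ, EM) 𝓘(ℝ, (Fin k → Fin k → ℂ) × (Fin k → ℂ)) ∞
          (fun y => (m y, v y)) x := hm.contMDiffAt.prodMk_space hv.contMDiffAt
      exact ContMDiffAt.comp (g := fun p : (Fin k → Fin k → ℂ) × (Fin k → ℂ) =>
          ((Matrix.of p.1)⁻¹.mulVec p.2) j) (f := fun y => (m y, v y)) x
        (contDiffAt_inv_mulVec_apply hx (v x) j).contMDiffAt hmv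
    have hre : ∀ j, ContMDiffAt 𝓘(ℝ, EM) 𝓘(ℝ, ℝ) ∞ (fun y => (c y j).re) x := fun j =>
      Complex.reCLM.contDiff.contMDiff.contMDiffAt.comp x (hc j)
    have him : ∀ j, ContMDiffAt 𝓘(ℝ, EM) 𝓘(ℝ, ℝ) ∞ (fun y => (c y j).im) x := fun j =>
      Complex.imCLM.contDiff.contMDiff.contMDiffAt.comp x (hc j)
    have e1 : ∀ y, (∑ j, c y j • lam j y).re (Z y) =
        ∑ j, ((c y j).re * (lam j y).re (Z y) - (c y j).im * (lam j y).im (Z y)) := fun y => by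
      simp [Cx.sum_re]
    have e2 : ∀ y, (∑ j, c y j • lam j y).im (Z y) =
        ∑ j, ((c y j).re * (lam j y).im (Z y) + (c y j).im * (lam j y).re (Z y)) := fun y => by
      simp [Cx.sum_im]
    simp only [e1, e2]
    exact ⟨ContMDiffAt.sum fun j _ => ((hre j).mul ((hlam j).1 Z hZ).contMDiffAt).sub
        ((him j).mul ((hlam j).2 Z hZ).contMDiffAt),
      ContMDiffAt.sum fun j _ => ((hre j).mul ((hlam j).2 Z hZ).contMDiffAt).add
        ((him j).mul ((hlam j).1 Z hZ).contMDiffAt)⟩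

/-- Let `W` be a field of subspaces of `(TM)^ℂ` of constant rank in which every vector extends to a
smooth section. Then functionals `β x` on `W x` which are smooth on sections of `W` are the
restrictions of a smooth complex 1-form: the local extensions are glued by a partition of unity. -/
theorem exists_oneForm_extension [SecondCountableTopology M] {k : ℕ}
    (hk : ∀ x, Module.finrank ℂ (W x) = k)
    (hW : ∀ x (w : W x), ∃ Y : CSec EM EM W, Y.at x = w) (β : Π x, W x →ₗ[ℂ] ℂ)
    (hβ : ∀ Y : CSec EM EM W, ContMDiff 𝓘(ℝ, EM) 𝓘(ℝ, ℂ) ∞ (fun x => β x (Y.at x))) :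
    ∃ ξ : Π x : M, Cx (TangentSpace 𝓘(ℝ, EM) x →L[ℝ] ℝ), SmoothCOneForm ξ ∧
      ∀ x, ∀ Y : W x, cEv (ξ x) Y = β x Y := by
  choose U hUo hUx ξ hξ hξs using exists_local_oneForm_extension hk hW β hβ
  have : LocallyCompactSpace M := ChartedSpace.locallyCompactSpace EM M
  obtain ⟨ρ, hρ⟩ := SmoothPartitionOfUnity.exists_isSubordinate 𝓘(ℝ, EM) isClosed_univ U hUo
    (fun x _ => Set.mem_iUnion.2 ⟨x, hUx x⟩)
  refine ⟨fun x => ∑ i ∈ ρ.finsupport x, (ρ i x : ℂ) • ξ i x, ⟨fun Z hZ => ?_, fun Z hZ => ?_⟩, ?_⟩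
  · have h := hρ.contMDiff_finsum_smul (n := ⊤) (g := fun i x => (ξ i x).re (Z x)) hUo
      fun i x hx => (hξs i Z hZ x hx).1.contMDiffWithinAt
    refine h.congr fun x => ?_
    refine Eq.trans ?_
      (ρ.sum_finsupport_smul_eq_finsum x (fun i x => (ξ i x).re (Z x)))
    simp [Cx.sum_re]
  · have h := hρ.contMDiff_finsum_smul (n := ⊤) (g := fun i x => (ξ i x).im (Z x)) hUo
      fun i x hx => (hξs i Z hZ x hx).2.contMDiffWithinAt
    refine h.congr fun x => ?_
    refine Eq.trans ?_
      (ρ.sum_finsupport_smul_eq_finsum x (fun i x => (ξ i x).im (Z x)))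
    simp [Cx.sum_im]
  · intro x Y
    rw [cEv_sum_left]
    have h : ∀ i ∈ ρ.finsupport x, cEv ((ρ i x : ℂ) • ξ i x) Y = ρ i x * β x Y := by
      intro i hi
      rw [cEv_smul_left, hξ i x]
      exact hρ i (subset_closure (by simpa using hi))
    rw [Finset.sum_congr rfl h, ← Finset.sum_mul, ← Complex.ofReal_sum,
      ρ.sum_finsupport x (Set.mem_univ x), Complex.ofReal_one, one_mul]

end Frame

/-! ### Sections of complexified bundles -/

section Sections

variable {EM : Type*} [NormedAddCommGroup EM] [NormedSpace ℝ EM]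
  {M : Type*} [TopologicalSpace M] [ChartedSpace EM M]
  {F : Type*} [NormedAddCommGroup F] [NormedSpace ℝ F]
  {V : M → Type*} [TopologicalSpace (TotalSpace F V)]
  [∀ x, AddCommGroup (V x)] [∀ x, Module ℝ (V x)] [∀ x, TopologicalSpace (V x)]
  [FiberBundle F V] [VectorBundle ℝ F V]

theorem SmoothCSec.add {r s : Π x : M, Cx (V x)} (hr : SmoothCSec EM F r)
    (hs : SmoothCSec EM F s) : SmoothCSec EM F (fun x => r x + s x) :=
  ⟨ContMDiff.add_section hr.1 hs.1, ContMDiff.add_section hr.2 hs.2⟩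

theorem SmoothCSec.sub {r s : Π x : M, Cx (V x)} (hr : SmoothCSec EM F r)
    (hs : SmoothCSec EM F s) : SmoothCSec EM F (fun x => r x - s x) :=
  ⟨ContMDiff.sub_section hr.1 hs.1, ContMDiff.sub_section hr.2 hs.2⟩

variable (EM F) in
theorem smoothCSec_zero : SmoothCSec EM F (fun x => (0 : Cx (V x))) :=
  ⟨contMDiff_zeroSection _ _, contMDiff_zeroSection _ _⟩

instance {S : Π x : M, Submodule ℂ (Cx (V x))} : Zero (CSec EM F S) :=
  ⟨⟨fun _ => 0, smoothCSec_zero EM F, fun x => (S x).zero_mem⟩⟩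

@[simp] theorem CSec.zero_val {S : Π x : M, Submodule ℂ (Cx (V x))} (x : M) :
    (0 : CSec EM F S).val x = 0 := rfl

@[simp] theorem CSec.zero_at {S : Π x : M, Submodule ℂ (Cx (V x))} (x : M) :
    (0 : CSec EM F S).at x = 0 := rfl

end Sections

/-! ### Sections of the bundle of `(1,0)`-vectors -/

namespace StandardCourant

variable {EM : Type*} [NormedAddCommGroup EM] [NormedSpace ℝ EM]
  {M : Type*} [TopologicalSpace M] [ChartedSpace EM M] [IsManifold 𝓘(ℝ, EM) ∞ M]
  {F : Type*} [NormedAddCommGroup F] [NormedSpace ℝ F]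
  {G : M → Type*} [TopologicalSpace (TotalSpace F G)]
  [∀ x, AddCommGroup (G x)] [∀ x, Module ℝ (G x)] [∀ x, TopologicalSpace (G x)]
  [FiberBundle F G] [VectorBundle ℝ F G]

theorem smoothE_add {u v : Π x : M, Fib EM G x} (hu : SmoothE F u) (hv : SmoothE F v) :
    SmoothE F (fun x => u x + v x) :=
  ⟨ContMDiff.add_section hu.1 hv.1, fun X hX => (hu.2.1 X hX).add (hv.2.1 X hX),
    ContMDiff.add_section hu.2.2 hv.2.2⟩

theorem smoothE_sub {u v : Π x : M, Fib EM G x} (hu : SmoothE F u) (hv : SmoothE F v) :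
    SmoothE F (fun x => u x - v x) :=
  ⟨ContMDiff.sub_section hu.1 hv.1, fun X hX => (hu.2.1 X hX).sub (hv.2.1 X hX),
    ContMDiff.sub_section hu.2.2 hv.2.2⟩

theorem smoothE_const_smul {u : Π x : M, Fib EM G x} (hu : SmoothE F u) (c : ℝ) :
    SmoothE F (fun x => c • u x) :=
  ⟨ContMDiff.const_smul_section hu.1, fun X hX => contMDiff_const.mul (hu.2.1 X hX),
    ContMDiff.const_smul_section hu.2.2⟩

variable (F) in
theorem exists_smoothE_apply_eq [FiniteDimensional ℝ EM] [T2Space M]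
    [ContMDiffVectorBundle ∞ F G 𝓘(ℝ, EM)] {x₀ : M} (w : Fib EM G x₀) :
    ∃ u : Π x : M, Fib EM G x, SmoothE F u ∧ u x₀ = w := by
  obtain ⟨X, hX, hX₀⟩ := exists_smoothSec_apply_eq (EM := EM) (F := EM)
    (V := fun x : M => TangentSpace 𝓘(ℝ, EM) x) w.1
  obtain ⟨ξ, hξ, hξ₀⟩ := exists_smoothOneForm_apply_eq w.2.1
  obtain ⟨r, hr, hr₀⟩ := exists_smoothSec_apply_eq (EM := EM) (F := F) (V := G) w.2.2
  exact ⟨fun x => (X x, ξ x, r x), ⟨hX, hξ, hr⟩, by simp [hX₀, hξ₀, hr₀]⟩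

variable [∀ x, IsTopologicalAddGroup (G x)] [∀ x, ContinuousSMul ℝ (G x)]
  {C : StandardCourant EM F G}

theorem GenAlmostComplex.mem_oneZero_iff (𝒥 : C.GenAlmostComplex) {x : M}
    {u : Cx (Fib EM G x)} :
    u ∈ 𝒥.oneZero x ↔ 𝒥.J x u.re = -u.im ∧ 𝒥.J x u.im = u.re := by
  rw [oneZero, Module.End.mem_eigenspace_iff, Cx.ext_iff]
  simp [Cx.mapLin]

section Extension

variable [FiniteDimensional ℝ EM] [T2Space M] [ContMDiffVectorBundle ∞ F G 𝓘(ℝ, EM)]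

/-- Every vector of the `(1,0)`-bundle extends to a section: extend it to a section of `E^ℂ` and
apply the projection `(1 - i𝒥) / 2`. -/
theorem GenAlmostComplex.exists_section_apply_eq (𝒥 : C.GenAlmostComplex) {x₀ : M}
    {w : Cx (Fib EM G x₀)} (hw : w ∈ 𝒥.oneZero x₀) :
    ∃ u : Π x : M, Cx (Fib EM G x), SmoothE F (fun x => (u x).re) ∧
      SmoothE F (fun x => (u x).im) ∧ (∀ x, u x ∈ 𝒥.oneZero x) ∧ u x₀ = w := by
  obtain ⟨a, ha, ha₀⟩ := exists_smoothE_apply_eq F w.re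
  obtain ⟨b, hb, hb₀⟩ := exists_smoothE_apply_eq F w.im
  rw [𝒥.mem_oneZero_iff] at hw
  refine ⟨fun x => ⟨(1 / 2 : ℝ) • (a x + 𝒥.J x (b x)), (1 / 2 : ℝ) • (b x - 𝒥.J x (a x))⟩,
    smoothE_const_smul (smoothE_add ha (𝒥.smooth _ hb)) _,
    smoothE_const_smul (smoothE_sub hb (𝒥.smooth _ ha)) _, fun x => ?_, ?_⟩
  · rw [𝒥.mem_oneZero_iff]
    constructor
    · have h : (1 / 2 : ℝ) • (𝒥.J x (a x) + -b x) = -((1 / 2 : ℝ) • (b x - 𝒥.J x (a x))) := by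
        refine Eq.trans ?_ (smul_neg (1 / 2 : ℝ) (b x - 𝒥.J x (a x)))
        rw [neg_sub, sub_eq_add_neg]
      simpa only [map_smul, map_add, 𝒥.sq] using h
    · simp only [map_smul, map_sub, 𝒥.sq, sub_neg_eq_add, add_comm]
  · ext1
    · simp only [ha₀, hb₀, hw.2, ← two_smul ℝ, smul_smul]; norm_num
    · simp only [ha₀, hb₀, hw.1, sub_neg_eq_add, ← two_smul ℝ, smul_smul]; norm_num

end Extension

/-! ### The subspaces `L(W, σ, D, ε)` and their sections -/

namespace DiracData

variable (S : C.DiracData)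

theorem mem_L_iff {x : M} {u : Cx (Fib EM G x)} :
    u ∈ S.L x ↔ ∃ (X : S.W x) (r : Cx (G x)), r ∈ S.D x ∧ tPart u = X ∧ gPart u = S.σ x X + r ∧
      ∀ Y : S.W x, cEv (cPart u) Y
        = 2 * S.ε x ![X, Y] - C.cIp x (S.σ x Y) (S.σ x X + (2 : ℂ) • r) := by
  constructor
  · rintro ⟨X, ξ, r, hr, hξ, rfl⟩
    exact ⟨X, r, hr, rfl, rfl, hξ⟩
  · rintro ⟨X, r, hr, hX, hg, hξ⟩
    refine ⟨X, cPart u, r, hr, hξ, ?_⟩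
    rw [← hX, ← hg]
    rfl

theorem ε_swap {x : M} (X Y : S.W x) : S.ε x ![X, Y] = -S.ε x ![Y, X] := by
  have := (S.ε x).map_swap ![Y, X] (i := 0) (j := 1) (by simp)
  refine Eq.trans (congrArg (S.ε x) (funext fun i => ?_)) this
  fin_cases i <;> rfl

theorem ε_add_right {x : M} (X Y Z : S.W x) :
    S.ε x ![X, Y + Z] = S.ε x ![X, Y] + S.ε x ![X, Z] := by
  have h : ∀ a : S.W x, Function.update ![X, 0] 1 a = ![X, a] := fun a =>
    funext fun i => by fin_cases i <;> rfl
  simpa only [h] using (S.ε x).map_update_add ![X, 0] 1 Y Z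

theorem ε_smul_right {x : M} (z : ℂ) (X Y : S.W x) :
    S.ε x ![X, z • Y] = z * S.ε x ![X, Y] := by
  have h : ∀ a : S.W x, Function.update ![X, 0] 1 a = ![X, a] := fun a =>
    funext fun i => by fin_cases i <;> rfl
  simpa only [h, smul_eq_mul] using (S.ε x).map_update_smul ![X, 0] 1 z Y

/-- The functional `Y ↦ 2 ε(X, Y) - ⟨σ(Y), σ(X) + 2 r⟩` on `W`: the restriction to `W` of the
covector part `ξ` of an element `X + ξ + σ(X) + r` of `L(W, σ, D, ε)`. -/
def covectorOnW {x : M} (X : S.W x) (r : Cx (G x)) : S.W x →ₗ[ℂ] ℂ where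
  toFun Y := 2 * S.ε x ![X, Y] - C.cIp x (S.σ x Y) (S.σ x X + (2 : ℂ) • r)
  map_add' Y Z := by rw [ε_add_right, map_add, cIp_add_left]; ring
  map_smul' z Y := by
    rw [ε_smul_right, map_smul, cIp_smul_left, RingHom.id_apply, smul_eq_mul]; ring

theorem isIsotropic {x : M} {r s : Cx (G x)} (hr : r ∈ S.D x) (hs : s ∈ S.D x) :
    C.cIp x r s = 0 :=
  (S.D_maximal x).prop r hr s hs

/-- `u` is the section `X + ξ + σ(X) + r` of `L(W, σ, D, ε)` for some 1-form `ξ`. -/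
structure IsLift (X : CSec EM EM S.W) (r : CSec EM F S.D) (u : Π x : M, Cx (Fib EM G x)) :
    Prop where
  smooth_re : SmoothE F (fun x => (u x).re)
  smooth_im : SmoothE F (fun x => (u x).im)
  tPart_eq : ∀ x, tPart (u x) = X.val x
  gPart_eq : ∀ x, gPart (u x) = S.σ x (X.at x) + r.val x
  cEv_eq : ∀ x (Y : S.W x), cEv (cPart (u x)) Y
    = 2 * S.ε x ![X.at x, Y] - C.cIp x (S.σ x Y) (S.σ x (X.at x) + (2 : ℂ) • r.val x)

variable {S}

theorem IsLift.mem_L {X : CSec EM EM S.W} {r : CSec EM F S.D} {u : Π x : M, Cx (Fib EM G x)}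
    (h : S.IsLift X r u) (x : M) : u x ∈ S.L x :=
  S.mem_L_iff.2 ⟨X.at x, r.val x, r.mem x, h.tPart_eq x, h.gPart_eq x, h.cEv_eq x⟩

/-- Every section of `L(W, σ, D, ε)` is a lift of sections of `W` and `D`. -/
theorem exists_isLift_of_mem_L {u : Π x : M, Cx (Fib EM G x)}
    (hre : SmoothE F (fun x => (u x).re)) (him : SmoothE F (fun x => (u x).im))
    (hu : ∀ x, u x ∈ S.L x) : ∃ X r, S.IsLift X r u := by
  choose X r hr ht hg hc using fun x => S.mem_L_iff.1 (hu x)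
  let X' : CSec EM EM S.W := ⟨fun x => tPart (u x), ⟨hre.1, him.1⟩, fun x => by simp [ht]⟩
  have hX' : ∀ x, X'.at x = X x := fun x => Subtype.ext (ht x)
  have hr' : ∀ x, r x = gPart (u x) - S.σ x (X'.at x) := fun x => by simp [hg, hX']
  let r' : CSec EM F S.D := ⟨r, by
    have : SmoothCSec EM F (fun x => gPart (u x)) := ⟨hre.2.2, him.2.2⟩
    rw [funext hr']
    exact this.sub (S.σ_smooth X'), hr⟩
  exact ⟨X', r', hre, him, fun x => rfl, fun x => by rw [hX']; exact hg x,
    fun x Y => by rw [hX']; exact hc x Y⟩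

section Existence

variable [FiniteDimensional ℝ EM] [T2Space M] [ContMDiffVectorBundle ∞ F G 𝓘(ℝ, EM)]
  {𝒥 : C.GenAlmostComplex}

/-- Vectors in `W` and `D` extend to sections of `W` and `D`. A priori `W` and `D` are fields of
subspaces only; the extensions are the components of a section of the smooth bundle `L`. -/
theorem exists_section_of_mem_W_of_mem_D
    (hL : ∀ x, (𝒥.oneZero x : Set (Cx (Fib EM G x))) = S.L x) {x : M} (w : S.W x)
    {r : Cx (G x)} (hr : r ∈ S.D x) :
    ∃ (X : CSec EM EM S.W) (s : CSec EM F S.D), X.at x = w ∧ s.val x = r := by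
  obtain ⟨ξ, hξ⟩ := exists_covector_extension (S.W x) (S.covectorOnW w r)
  let u₀ : Cx (Fib EM G x) :=
    ⟨(w.1.re, ξ.re, (S.σ x w + r).re), (w.1.im, ξ.im, (S.σ x w + r).im)⟩
  have hu₀ : u₀ ∈ 𝒥.oneZero x := by
    rw [← SetLike.mem_coe, hL]
    exact ⟨w, ξ, r, hr, hξ, rfl⟩
  obtain ⟨u, hre, him, hu, hux⟩ := 𝒥.exists_section_apply_eq hu₀
  obtain ⟨X, s, h⟩ := exists_isLift_of_mem_L (S := S) hre him fun y => by
    rw [← hL]; exact hu y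
  have hX : X.at x = w := Subtype.ext <| (h.tPart_eq x).symm.trans <| by
    rw [hux]; rfl
  refine ⟨X, s, hX, ?_⟩
  have h1 := h.gPart_eq x
  rw [hux, hX] at h1
  exact (add_left_cancel h1).symm

/-- Every pair of sections of `W` and `D` lifts to a section of `L(W, σ, D, ε)`. -/
theorem exists_isLift [SecondCountableTopology M]
    (hL : ∀ x, (𝒥.oneZero x : Set (Cx (Fib EM G x))) = S.L x)
    (X : CSec EM EM S.W) (r : CSec EM F S.D) : ∃ u, S.IsLift X r u := by
  obtain ⟨k, hk⟩ := S.W_rank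
  have hW : ∀ x (w : S.W x), ∃ Y : CSec EM EM S.W, Y.at x = w := fun x w => by
    obtain ⟨Y, -, hY, -⟩ := exists_section_of_mem_W_of_mem_D hL w (S.D x).zero_mem
    exact ⟨Y, hY⟩
  obtain ⟨ξ, hξ, h⟩ := exists_oneForm_extension hk hW
    (fun x => S.covectorOnW (X.at x) (r.val x)) fun Y => by
      have h1 : SmoothCSec EM F (fun x => S.σ x (X.at x) + (2 : ℂ) • r.val x) := by
        simp only [two_smul]
        exact (S.σ_smooth X).add (r.smooth.add r.smooth)
      have h2 := S.ε_smooth X Y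
      have h3 := (h2.add h2).sub (C.contMDiff_cIp (S.σ_smooth Y) h1)
      simp only [← two_mul] at h3
      exact h3
  have hg := (S.σ_smooth X).add r.smooth
  exact ⟨fun x => ⟨((X.val x).re, (ξ x).re, (S.σ x (X.at x) + r.val x).re),
    ((X.val x).im, (ξ x).im, (S.σ x (X.at x) + r.val x).im)⟩,
    ⟨X.smooth.1, hξ.1, hg.1⟩, ⟨X.smooth.2, hξ.2, hg.2⟩, fun x => rfl, fun x => rfl, h⟩

end Existence

end DiracData

end StandardCourant

/-! ### The Dorfman bracket of two sections of `L(W, σ, D, ε)` -/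

namespace StandardCourant

namespace DiracData

variable {EM : Type*} [NormedAddCommGroup EM] [NormedSpace ℝ EM]
  {M : Type*} [TopologicalSpace M] [ChartedSpace EM M] [IsManifold 𝓘(ℝ, EM) ∞ M]
  {F : Type*} [NormedAddCommGroup F] [NormedSpace ℝ F]
  {G : M → Type*} [TopologicalSpace (TotalSpace F G)]
  [∀ x, AddCommGroup (G x)] [∀ x, Module ℝ (G x)] [∀ x, TopologicalSpace (G x)]
  [∀ x, IsTopologicalAddGroup (G x)] [∀ x, ContinuousSMul ℝ (G x)]
  [FiberBundle F G] [VectorBundle ℝ F G]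
  {C : StandardCourant EM F G} {S : C.DiracData}

/-- The section `(∇ + ad_σ)_X r`. -/
def partialConn (X : CSec EM EM S.W) (r : CSec EM F S.D) (x : M) : Cx (G x) :=
  C.cNabla X.val r.val x + C.cBr x (S.σ x (X.at x)) (r.val x)

/-- The section `R(X, Y) + (d^∇ σ)(X, Y) + [σ(X), σ(Y)]`, whose adjoint action is the curvature of
the partial connection `∇ + ad_σ`. -/
def curv (hW : S.Involutive) (X Y : CSec EM EM S.W) (x : M) : Cx (G x) :=
  C.cR x (X.val x) (Y.val x) + dσ hW X Y x + C.cBr x (S.σ x (X.at x)) (S.σ x (Y.at x))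

/-- The 3-form `2 dε + H + ⟨d^∇σ ∧ σ⟩ + 2⟨R ∧ σ⟩ + 2⟨[σ, σ], σ⟩` on `W`. -/
def threeForm (hW : S.Involutive) (X Y Z : CSec EM EM S.W) (x : M) : ℂ :=
  2 * dε hW X Y Z x + C.cH x (X.val x) (Y.val x) (Z.val x) + wedgeσ (dσ hW) X Y Z x
    + 2 * wedgeσ (fun X Y x => C.cR x (X.val x) (Y.val x)) X Y Z x
    + 2 * C.cIp x (C.cBr x (S.σ x (X.at x)) (S.σ x (Y.at x))) (S.σ x (Z.at x))

section Zero

variable (X : CSec EM EM S.W) (r : CSec EM F S.D) (x : M)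

theorem partialConn_zero_left : partialConn (0 : CSec EM EM S.W) r x = 0 := by
  ext <;> simp [partialConn, cNabla, cBr, Cx.map₂]

theorem partialConn_zero_right : partialConn X (0 : CSec EM F S.D) x = 0 := by
  have h : C.nabla (fun _ => 0) x = 0 := congrFun C.nabla.zero x
  ext <;> simp [partialConn, cNabla, cBr, Cx.map₂, h]

end Zero

variable (hW : S.Involutive) {X Y V : CSec EM EM S.W} {r s : CSec EM F S.D}
  {u v : Π x : M, Cx (Fib EM G x)}

/-- For lifts of `(X, r)` and `(Y, s)`, the part of the Dorfman bracket which has to lie in `D`. -/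
theorem IsLift.gPart_cDorfman_sub (hu : S.IsLift X r u) (hv : S.IsLift Y s v) (x : M) :
    gPart (C.cDorfman u v x) - S.σ x (bracket hW X Y x) =
      curv hW X Y x + partialConn X s x - partialConn Y r x + C.cBr x (r.val x) (s.val x) := by
  rw [C.gPart_cDorfman]
  simp only [hu.tPart_eq, hv.tPart_eq, hu.gPart_eq, hv.gPart_eq]
  rw [C.cNabla_add (S.σ_smooth X) r.smooth, C.cNabla_add (S.σ_smooth Y) s.smooth]
  simp only [cBr_add_left, cBr_add_right, curv, partialConn, dσ]
  rw [C.cBr_swap x (r.val x) (S.σ x (Y.at x))]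
  abel

/-- The derivative of the function `ξ(V)`, where `ξ` is the covector part of a lift. -/
theorem IsLift.cDer_cEv (hu : S.IsLift X r u) (V : CSec EM EM S.W)
    (Z : Π x : M, Cx (TangentSpace 𝓘(ℝ, EM) x)) (x : M) :
    cDer Z (fun y => cEv (cPart (u y)) (V.val y)) x =
      2 * cDer Z (fun y => S.ε y ![X.at y, V.at y]) x
      - (C.cIp x (C.cNabla Z (fun y => S.σ y (V.at y)) x) (S.σ x (X.at x) + (2 : ℂ) • r.val x)
      + C.cIp x (S.σ x (V.at x)) (C.cNabla Z (fun y => S.σ y (X.at y)) x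
          + (2 : ℂ) • C.cNabla Z r.val x)) := by
  have h1 : SmoothCSec EM F (fun x => S.σ x (X.at x) + (r.val x + r.val x)) :=
    (S.σ_smooth X).add (r.smooth.add r.smooth)
  have h2 := S.ε_smooth X V
  have h3 := C.contMDiff_cIp (S.σ_smooth V) h1
  -- The factors `2` are written as sums, so that only additivity of `∇` is needed.
  have h4 : ∀ y, cEv (cPart (u y)) (V.val y) = (S.ε y ![X.at y, V.at y] + S.ε y ![X.at y, V.at y])
      + -1 * C.cIp y (S.σ y (V.at y)) (S.σ y (X.at y) + (r.val y + r.val y)) := fun y => by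
    rw [← two_smul ℂ (r.val y)]
    refine (hu.cEv_eq y (V.at y)).trans ?_
    ring
  simp only [h4]
  have h5 := cDer_const_mul (x := x) h3 (-1) Z
  have h6 := contMDiff_complex_const_mul (-1) h3
  simp only [Complex.ofReal_neg, Complex.ofReal_one] at h5 h6
  have h7 : ContMDiff 𝓘(ℝ, EM) 𝓘(ℝ, ℂ) ∞
      (fun y => S.ε y ![X.at y, V.at y] + S.ε y ![X.at y, V.at y]) := h2.add h2
  rw [cDer_add h7 h6, cDer_add h2 h2, h5, C.cDer_cIp (S.σ_smooth V) h1,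
    C.cNabla_add (S.σ_smooth X) (r.smooth.add r.smooth), C.cNabla_add r.smooth r.smooth,
    two_smul, two_smul]
  ring

variable [FiniteDimensional ℝ EM] [T2Space M]

/-- For lifts of `(X, r)` and `(Y, s)`, the covector part of the Dorfman bracket, restricted to `W`,
is the one prescribed in `L(W, σ, D, ε)` (the first two terms on the right) up to the 3-form
`threeForm` and scalar products of `r` and `s` with values of `curv` and `partialConn`. -/
theorem IsLift.cEv_cDorfman (hu : S.IsLift X r u) (hv : S.IsLift Y s v) (V : CSec EM EM S.W)
    (x : M) :
    cEv (cPart (C.cDorfman u v x)) (V.val x) =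
      2 * S.ε x ![bracket hW X Y x, V.at x]
      - C.cIp x (S.σ x (V.at x)) (S.σ x (bracket hW X Y x)
        + (2 : ℂ) • (gPart (C.cDorfman u v x) - S.σ x (bracket hW X Y x)))
      + threeForm hW X Y V x - 2 * C.cIp x (curv hW X V x) (s.val x)
      + 2 * C.cIp x (curv hW Y V x) (r.val x) + 2 * C.cIp x (partialConn V r x) (s.val x) := by
  rw [hu.gPart_cDorfman_sub hW hv,
    C.cEv_cPart_cDorfman hu.smooth_re hu.smooth_im hv.smooth_re hv.smooth_im V.smooth]
  simp only [hu.tPart_eq, hv.tPart_eq, hu.gPart_eq, hv.gPart_eq]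
  have e1 : cEv (cPart (v x)) (cLie X.val V.val x) = _ := hv.cEv_eq x (bracket hW X V x)
  have e2 : cEv (cPart (u x)) (cLie Y.val V.val x) = _ := hu.cEv_eq x (bracket hW Y V x)
  have b1 : bracket hW V X x = -bracket hW X V x := Subtype.ext (cLie_swap V.val X.val x)
  rw [e1, e2, hu.cDer_cEv V, hv.cDer_cEv V, hu.cDer_cEv Y,
    C.cNabla_add (S.σ_smooth X) r.smooth]
  simp only [threeForm, curv, partialConn, dσ, dε, wedgeσ, b1, map_neg, C.cR_swap x (V.val x),
    S.ε_swap (X.at x) (bracket hW Y V x), S.ε_swap (Y.at x) (bracket hW X V x),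
    cIp_add_left, cIp_add_right, cIp_sub_left, cIp_sub_right, cIp_neg_left,
    cIp_smul_right]
  -- What remains after cancellation is the `ad`-invariance of the scalar product, applied to
  -- `[σ(X), s]`, `[σ(Y), r]` and `[r, s]`, paired with `σ(V)`.
  have k1 := C.cIp_cBr_left x (S.σ x (X.at x)) (S.σ x (V.at x)) (s.val x)
  have k2 := C.cIp_cBr_left x (S.σ x (Y.at x)) (S.σ x (V.at x)) (r.val x)
  have k3 := C.cIp_cBr_left x (r.val x) (S.σ x (V.at x)) (s.val x)
  rw [C.cBr_swap x (r.val x), cIp_neg_left] at k3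
  simp only [C.cIp_symm x] at k1 k2 k3 ⊢
  linear_combination 2 * k1 - 2 * k2 + 2 * k3

end DiracData

end StandardCourant

/-! ### Integrability -/

namespace StandardCourant

namespace DiracData

variable {EM : Type*} [NormedAddCommGroup EM] [NormedSpace ℝ EM]
  {M : Type*} [TopologicalSpace M] [ChartedSpace EM M] [IsManifold 𝓘(ℝ, EM) ∞ M]
  {F : Type*} [NormedAddCommGroup F] [NormedSpace ℝ F]
  {G : M → Type*} [TopologicalSpace (TotalSpace F G)]
  [∀ x, AddCommGroup (G x)] [∀ x, Module ℝ (G x)] [∀ x, TopologicalSpace (G x)]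
  [∀ x, IsTopologicalAddGroup (G x)] [∀ x, ContinuousSMul ℝ (G x)]
  [FiberBundle F G] [VectorBundle ℝ F G]
  {C : StandardCourant EM F G} {S : C.DiracData}
  {X Y V : CSec EM EM S.W} {r s : CSec EM F S.D} {u v : Π x : M, Cx (Fib EM G x)}

theorem IsLift.tPart_cDorfman (hu : S.IsLift X r u) (hv : S.IsLift Y s v) (x : M) :
    tPart (C.cDorfman u v x) = cLie X.val Y.val x := by
  rw [← funext hu.tPart_eq, ← funext hv.tPart_eq]
  exact C.tPart_cDorfman u v x

/-- Membership of a Dorfman bracket in `L(W, σ, D, ε)`, given that its vector part lies in `W`. -/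
theorem IsLift.cDorfman_mem_L_iff (hW : S.Involutive) (hu : S.IsLift X r u)
    (hv : S.IsLift Y s v) (x : M) :
    C.cDorfman u v x ∈ S.L x ↔
      gPart (C.cDorfman u v x) - S.σ x (bracket hW X Y x) ∈ S.D x ∧
      ∀ w : S.W x, cEv (cPart (C.cDorfman u v x)) w =
        2 * S.ε x ![bracket hW X Y x, w] - C.cIp x (S.σ x w) (S.σ x (bracket hW X Y x)
          + (2 : ℂ) • (gPart (C.cDorfman u v x) - S.σ x (bracket hW X Y x))) := by
  have ht := hu.tPart_cDorfman hv x
  rw [S.mem_L_iff]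
  constructor
  · rintro ⟨Z, t, htD, hZ, hg, hc⟩
    obtain rfl : Z = bracket hW X Y x := Subtype.ext (hZ.symm.trans ht)
    obtain rfl : t = gPart (C.cDorfman u v x) - S.σ x (bracket hW X Y x) := by simp [hg]
    exact ⟨htD, hc⟩
  · rintro ⟨hD, hc⟩
    exact ⟨bracket hW X Y x, _, hD, ht, by simp, hc⟩

theorem integrable_iff_forall_isLift {𝒥 : C.GenAlmostComplex}
    (hL : ∀ x, (𝒥.oneZero x : Set (Cx (Fib EM G x))) = S.L x) :
    𝒥.Integrable ↔ ∀ X r u Y s v, S.IsLift X r u → S.IsLift Y s v →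
      ∀ x, C.cDorfman u v x ∈ S.L x := by
  have hL' : ∀ x (w : Cx (Fib EM G x)), w ∈ 𝒥.oneZero x ↔ w ∈ S.L x := fun x w => by
    rw [← SetLike.mem_coe, hL]
  simp only [GenAlmostComplex.Integrable, hL']
  constructor
  · intro h X r u Y s v hu hv
    exact h u v hu.smooth_re hu.smooth_im hv.smooth_re hv.smooth_im hu.mem_L hv.mem_L
  · intro h u v hu hu' hv hv' huL hvL
    obtain ⟨X, r, hXu⟩ := exists_isLift_of_mem_L hu hu' huL
    obtain ⟨Y, s, hYv⟩ := exists_isLift_of_mem_L hv hv' hvL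
    exact h X r u Y s v hXu hYv

variable [FiniteDimensional ℝ EM] [T2Space M] [ContMDiffVectorBundle ∞ F G 𝓘(ℝ, EM)]
  {𝒥 : C.GenAlmostComplex}

theorem conditions_of_integrable [SecondCountableTopology M]
    (hL : ∀ x, (𝒥.oneZero x : Set (Cx (Fib EM G x))) = S.L x) (h : 𝒥.Integrable) :
    ∃ hW : S.Involutive, S.IsLieSubalgebraBundle ∧ S.PartialConnectionPreserves ∧
      CurvatureCondition hW ∧ ThreeFormCondition hW := by
  rw [integrable_iff_forall_isLift hL] at h
  have hW : S.Involutive := fun X Y x => by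
    obtain ⟨u, hu⟩ := exists_isLift hL X 0
    obtain ⟨v, hv⟩ := exists_isLift hL Y 0
    obtain ⟨Z, t, -, hZ, -⟩ := S.mem_L_iff.1 (h _ _ _ _ _ _ hu hv x)
    rw [← hu.tPart_cDorfman hv x, hZ]
    exact Z.2
  have hD : ∀ X Y r s x, curv hW X Y x + partialConn X s x - partialConn Y r x
      + C.cBr x (r.val x) (s.val x) ∈ S.D x := fun X Y r s x => by
    obtain ⟨u, hu⟩ := exists_isLift hL X r
    obtain ⟨v, hv⟩ := exists_isLift hL Y s
    rw [← hu.gPart_cDorfman_sub hW hv]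
    exact ((hu.cDorfman_mem_L_iff hW hv x).1 (h _ _ _ _ _ _ hu hv x)).1
  -- Setting some of `X`, `Y`, `r`, `s` equal to zero isolates the terms of this sum.
  have hcurv : ∀ X Y x, curv hW X Y x ∈ S.D x := fun X Y x => by
    simpa [partialConn_zero_right, cBr_zero_left] using hD X Y 0 0 x
  refine ⟨hW, fun x r hr s hs => ?_, fun X r x => ?_, hcurv, fun X Y V x => ?_⟩
  · obtain ⟨-, r', -, rfl⟩ := exists_section_of_mem_W_of_mem_D hL 0 hr
    obtain ⟨-, s', -, rfl⟩ := exists_section_of_mem_W_of_mem_D hL 0 hs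
    have := hD 0 0 r' s' x
    rw [partialConn_zero_left, partialConn_zero_left, add_zero, sub_zero] at this
    exact ((S.D x).add_mem_iff_right (hcurv 0 0 x)).1 this
  · have := hD X 0 0 r x
    rw [partialConn_zero_left, sub_zero, CSec.zero_val, cBr_zero_left, add_zero] at this
    exact ((S.D x).add_mem_iff_right (hcurv X 0 x)).1 this
  · obtain ⟨u, hu⟩ := exists_isLift hL X 0
    obtain ⟨v, hv⟩ := exists_isLift hL Y 0
    have h1 := ((hu.cDorfman_mem_L_iff hW hv x).1 (h _ _ _ _ _ _ hu hv x)).2 (V.at x)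
    have h2 := hu.cEv_cDorfman hW hv V x
    simp only [CSec.zero_val, cIp_zero_right] at h2
    change threeForm hW X Y V x = 0
    linear_combination -h1.symm.trans h2

theorem integrable_of_conditions
    (hL : ∀ x, (𝒥.oneZero x : Set (Cx (Fib EM G x))) = S.L x) (hW : S.Involutive)
    (hB : S.IsLieSubalgebraBundle) (hC : S.PartialConnectionPreserves)
    (hD : CurvatureCondition hW) (hE : ThreeFormCondition hW) : 𝒥.Integrable := by
  refine (integrable_iff_forall_isLift hL).2 fun X r u Y s v hu hv x =>
    (hu.cDorfman_mem_L_iff hW hv x).2 ⟨?_, fun w => ?_⟩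
  · rw [hu.gPart_cDorfman_sub hW hv]
    exact (S.D x).add_mem ((S.D x).sub_mem ((S.D x).add_mem (hD X Y x) (hC X s x)) (hC Y r x))
      (hB x _ (r.mem x) _ (s.mem x))
  · obtain ⟨V, -, rfl, -⟩ := exists_section_of_mem_W_of_mem_D hL w (S.D x).zero_mem
    refine (hu.cEv_cDorfman hW hv V x).trans ?_
    have h0 : threeForm hW X Y V x = 0 := hE X Y V x
    have h1 : C.cIp x (curv hW X V x) (s.val x) = 0 := S.isIsotropic (hD X V x) (s.mem x)
    have h2 : C.cIp x (curv hW Y V x) (r.val x) = 0 := S.isIsotropic (hD Y V x) (r.mem x)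
    have h3 : C.cIp x (partialConn V r x) (s.val x) = 0 := S.isIsotropic (hC V r x) (s.mem x)
    rw [h0, h1, h2, h3]
    ring

end DiracData

end StandardCourant

end Courant

end

theorem mainTheorem4
    {EM : Type*} [NormedAddCommGroup EM] [NormedSpace ℝ EM] [FiniteDimensional ℝ EM]
    {M : Type*} [TopologicalSpace M] [T2Space M] [SecondCountableTopology M]
    [ChartedSpace EM M] [IsManifold 𝓘(ℝ, EM) ∞ M]
    {F : Type*} [NormedAddCommGroup F] [NormedSpace ℝ F] [FiniteDimensional ℝ F]
    {G : M → Type*} [TopologicalSpace (TotalSpace F G)]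
    [∀ x, AddCommGroup (G x)] [∀ x, Module ℝ (G x)] [∀ x, TopologicalSpace (G x)]
    [∀ x, IsTopologicalAddGroup (G x)] [∀ x, ContinuousSMul ℝ (G x)]
    [FiberBundle F G] [VectorBundle ℝ F G] [ContMDiffVectorBundle ∞ F G 𝓘(ℝ, EM)]
    (C : Courant.StandardCourant EM F G)
    (𝒥 : C.GenAlmostComplex) (S : C.DiracData)
    (hL : ∀ x, (𝒥.oneZero x : Set (Courant.Cx (Courant.Fib EM G x))) = S.L x) :
    𝒥.Integrable ↔
      ∃ hW : S.Involutive,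
        S.IsLieSubalgebraBundle ∧
        S.PartialConnectionPreserves ∧
        Courant.StandardCourant.DiracData.CurvatureCondition hW ∧
        Courant.StandardCourant.DiracData.ThreeFormCondition hW :=
  ⟨Courant.StandardCourant.DiracData.conditions_of_integrable hL, fun ⟨hW, hB, hC, hD, hE⟩ =>
    Courant.StandardCourant.DiracData.integrable_of_conditions hL hW hB hC hD hE⟩
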